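/- **Setting.** Let $K$ devices and $N$ preambles be given, let $\mathcal K=\{1,\dots,K\}$, $\mathcal N=\{1,\dots,N\}$, and let $\mathbf x_1,\dots,\mathbf x_I\in\{0,1\}^K$ ($I\ge 1$) be samples of the device activity states. For $\mathbf A=(a_{k,n})_{k\in\mathcal K,n\in\mathcal N}$, $\epsilon\in\mathbb R$ and $\mathbf x\in\{0,1\}^K$ put $$T(\mathbf A,\epsilon,\mathbf x)=\sum_{n}\sum_{k}x_ka_{k,n}\epsilon\prod_{\ell\ne k}(1-x_\ell a_{\ell,n}\epsilon),\qquad \bar T_{\rm st}(\mathbf A,\epsilon)=\frac1I\sum_{i=1}^I T(\mathbf A,\epsilon,\mathbf x_i),$$ $$g_{k,n}(\mathbf A,\epsilon,\mathbf x)=\prod_{\ell\neq k}(1-x_\ell a_{\ell,n}\epsilon)-\epsilon\sum_{\ell\ne k}x_\ell a_{\ell,n}\prod_{j\ne \ell,\,j\neq k}(1-x_ja_{j,n}\epsilon).$$ The sample average throughput maximisation problem is to maximise $\bar T_{\rm st}$ over the convex set $\mathcal F$ of all $(\mathbf A,\epsilon)$ with $a_{k,n}\ge 0$, $\sum_n a_{k,n}=1$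 for all $k$, and $0\le\epsilon\le1$. A stationary point of it is a point $z\in\mathcal F$ with $\nabla \bar T_{\rm st}(z)^{\mathsf T}(w-z)\le 0$ for all $w\in\mathcal F$. Let $M$ divide $I$, and let $\{1,\dots,I\}$ be partitioned into $M$ disjoint mini-batches $\mathcal I_1,\dots,\mathcal I_M$, each of size $I/M$. Let $\tau>0$, and let $(\rho^{(t)})_{t\ge1}$, $(\omega^{(t)})_{t\ge1}$ be positive step sizes with $\rho^{(t)}\to0$, $\sum_t\rho^{(t)}=\infty$, $\sum_t(\rho^{(t)})^2<\infty$, with $\omega^{(t)}\to0$, $\sum_t\omega^{(t)}=\infty$, $\sum_t(\omega^{(t)})^2<\infty$, and with $\omega^{(t)}/\rho^{(t)}\to0$. **Algorithm (mini-batch stochastic parallel successive convex approximation, without stopping).** Let $\mathbf a_k^{(0)}=\mathbf e_{n_k}$ with $n_k$ uniformly distributed on $\mathcal N$, $\epsilon^{(0)}=1$, $c_{k,n}^{(0)}=c_0^{(0)}=0$. At iteration $t\ge1$ draw $\xi^{(t)}$ uniformly from $\{1,\dots,M\}$, the $\xi^{(t)}$ being mutually independent and independent of the initial preambles $(n_k)_{k}$.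 Put $$c_{k,n}^{(t)}=(1-\rho^{(t)})c_{k,n}^{(t-1)}+\rho^{(t)}\frac MI\,\epsilon^{(t-1)}\sum_{i\in\mathcal I_{\xi^{(t)}}}x_{i,k}\,g_{k,n}(\mathbf A^{(t-1)},\epsilon^{(t-1)},\mathbf x_i),$$ $$c_{0}^{(t)}=(1-\rho^{(t)})c_{0}^{(t-1)}+\rho^{(t)}\frac MI\sum_{i\in\mathcal I_{\xi^{(t)}}}\sum_{k}x_{i,k}\sum_n a^{(t-1)}_{k,n}\,g_{k,n}(\mathbf A^{(t-1)},\epsilon^{(t-1)},\mathbf x_i),$$ choose $\hat{\mathbf a}_k^{(t)}\in\{\mathbf e_m: m\in\arg\max_{n}c_{k,n}^{(t)}\}$, let $\hat\epsilon^{(t)}=\min\bigl(\max\bigl(\epsilon^{(t-1)}+\tfrac{c_0^{(t)}}{2\tau},0\bigr),1\bigr)$, and update $$\mathbf a_k^{(t)}=(1-\omega^{(t)})\mathbf a_k^{(t-1)}+\omega^{(t)}\hat{\mathbf a}_k^{(t)}\quad(k\in\mathcal K),\qquad \epsilon^{(t)}=(1-\omega^{(t)})\epsilon^{(t-1)}+\omega^{(t)}\hat\epsilon^{(t)}.$$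 **Theorem 8 (Convergence of Algorithm 4).** Almost surely the following holds: if $\arg\max_{n\in\mathcal N}c_{k,n}^{(t)}$ is a singleton for all $k\in\mathcal K$ and all $t\ge1$, then every limit point of $\{(\mathbf A^{(t)},\epsilon^{(t)})\}_t$ is a stationary point of the sample average throughput maximisation problem. -/

import Mathlib

open Filter Topology MeasureTheory ProbabilityTheory
open scoped ENNReal

noncomputable section

namespace RandomAccess

/-- Average number of devices that successfully access the base station, conditional on the
activity states `x`: preamble selection probabilities `A k n`, access barring factor `ε`. -/
def throughput {K N : ℕ} (A : Fin K → Fin N → ℝ) (ε : ℝ) (x : Fin K → ℝ) : ℝ :=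
  ∑ n, ∑ k, x k * A k n * ε * ∏ l ∈ Finset.univ.erase k, (1 - x l * A l n * ε)

/-- Sample average throughput of the samples `x i`, as a function of the pair `(A, ε)`. -/
def sampleThroughput {K N I : ℕ} (x : Fin I → Fin K → ℝ)
    (z : (Fin K → Fin N → ℝ) × ℝ) : ℝ :=
  1 / (I : ℝ) * ∑ i, throughput z.1 z.2 (x i)

/-- Feasible pairs `(A, ε)`: each `A k` is a probability vector and `ε` lies in `[0, 1]`. -/
def feasibleSet (K N : ℕ) : Set ((Fin K → Fin N → ℝ) × ℝ) :=
  {z | (∀ k n, 0 ≤ z.1 k n) ∧ (∀ k, ∑ n, z.1 k n = 1) ∧ 0 ≤ z.2 ∧ z.2 ≤ 1}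

/-- Stationary point (first-order optimality) of the problem of maximising `f` over a convex
set `S`. -/
def IsStationaryPointMax {E : Type*} [NormedAddCommGroup E] [NormedSpace ℝ E]
    (f : E → ℝ) (S : Set E) (z : E) : Prop :=
  z ∈ S ∧ DifferentiableAt ℝ f z ∧ ∀ w ∈ S, fderiv ℝ f z (w - z) ≤ 0

/-- The function `g_{k,n}(A, ε, x)`; one has `∂T/∂a_{k,n} = x_k ε g_{k,n}` and
`∂T/∂ε = ∑ k, x_k ∑ n, a_{k,n} g_{k,n}` for the conditional throughput `T`. -/
def g {K N : ℕ} (A : Fin K → Fin N → ℝ) (ε : ℝ) (x : Fin K → ℝ) (k : Fin K) (n : Fin N) : ℝ :=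
  ∏ l ∈ Finset.univ.erase k, (1 - x l * A l n * ε)
    - ε * ∑ l ∈ Finset.univ.erase k,
        x l * A l n * ∏ j ∈ (Finset.univ.erase k).erase l, (1 - x j * A j n * ε)

/-- The family `batch` partitions the `I` samples into `M` disjoint mini-batches of
size `I / M`, where `M` divides `I`. -/
structure IsMiniBatchPartition {I M : ℕ} (batch : Fin M → Finset (Fin I)) : Prop where
  dvd : M ∣ I
  card : ∀ m, (batch m).card = I / M
  disjoint : ∀ m m', m ≠ m' → Disjoint (batch m) (batch m')
  cover : ∀ i, ∃ m, i ∈ batch m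

/-- Positive diminishing step size `s t`, `t ≥ 1`: `s t → 0`, `∑ s t = ∞`, `∑ (s t)^2 < ∞`. -/
structure IsDiminishingStepSize (s : ℕ → ℝ) : Prop where
  pos : ∀ t, 1 ≤ t → 0 < s t
  tendsto_zero : Tendsto s atTop (𝓝 0)
  sum_eq_top : Tendsto (fun T : ℕ => ∑ t ∈ Finset.Icc 1 T, s t) atTop atTop
  sum_sq_lt_top : Summable (fun t : ℕ => s (t + 1) ^ 2)

/-- The averaged partial derivatives `c_{k,n}^{(t)}` computed from the iterates `A`, `ε` and the
mini-batch indices `ξ`. -/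
def cA {K N I M : ℕ} (x : Fin I → Fin K → ℝ) (batch : Fin M → Finset (Fin I)) (ρ : ℕ → ℝ)
    (ξ : ℕ → Fin M) (A : ℕ → Fin K → Fin N → ℝ) (ε : ℕ → ℝ) : ℕ → Fin K → Fin N → ℝ
  | 0 => fun _ _ => 0
  | t + 1 => fun k n =>
      (1 - ρ (t + 1)) * cA x batch ρ ξ A ε t k n
        + ρ (t + 1) * ((M : ℝ) / (I : ℝ) * ε t *
            ∑ i ∈ batch (ξ (t + 1)), x i k * g (A t) (ε t) (x i) k n)

/-- The averaged partial derivatives `c_0^{(t)}` with respect to the access barring factor. -/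
def cEps {K N I M : ℕ} (x : Fin I → Fin K → ℝ) (batch : Fin M → Finset (Fin I)) (ρ : ℕ → ℝ)
    (ξ : ℕ → Fin M) (A : ℕ → Fin K → Fin N → ℝ) (ε : ℕ → ℝ) : ℕ → ℝ
  | 0 => 0
  | t + 1 =>
      (1 - ρ (t + 1)) * cEps x batch ρ ξ A ε t
        + ρ (t + 1) * ((M : ℝ) / (I : ℝ) *
            ∑ i ∈ batch (ξ (t + 1)), ∑ k, x i k * ∑ n, A t k n * g (A t) (ε t) (x i) k n)

/-- The set of maximisers `argmax_n c n`. -/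
def argmaxSet {N : ℕ} (c : Fin N → ℝ) : Set (Fin N) := {m | ∀ n, c n ≤ c m}

/-- `(A t, ε t)`, `t = 0, 1, …`, is the (unstopped) sequence of iterates of mini-batch stochastic
parallel successive convex approximation along one realisation `n₀`, `ξ` of the initial
preambles and of the mini-batch indices. In iteration `t + 1`, block `k` moves towards the unit
vector `e_m` of some (arbitrarily chosen) `m ∈ argmax_n c_{k,n}^{(t+1)}`, a maximiser of the
linear approximation over the simplex, and `ε` moves towards the maximiser over `[0, 1]`
of `c_0^{(t+1)} ε - τ (ε - ε^{(t)})^2`. -/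
structure IsSCARun {K N I M : ℕ} (x : Fin I → Fin K → ℝ) (batch : Fin M → Finset (Fin I))
    (ρ ω : ℕ → ℝ) (τ : ℝ) (n₀ : Fin K → Fin N) (ξ : ℕ → Fin M)
    (A : ℕ → Fin K → Fin N → ℝ) (ε : ℕ → ℝ) : Prop where
  init_A : ∀ k, A 0 k = Pi.single (n₀ k) 1
  init_eps : ε 0 = 1
  step_A : ∀ t k, ∃ m ∈ argmaxSet (cA x batch ρ ξ A ε (t + 1) k),
    A (t + 1) k = (1 - ω (t + 1)) • A t k + ω (t + 1) • Pi.single m (1 : ℝ)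
  step_eps : ∀ t, ε (t + 1) = (1 - ω (t + 1)) * ε t
    + ω (t + 1) * min (max (ε t + cEps x batch ρ ξ A ε (t + 1) / (2 * τ)) 0) 1

end RandomAccess

end

/-! Because `ω / ρ → 0`, the iterates look frozen on the time scale of the averaging. The averaged
derivatives therefore track the true gradient at the current iterate: the mini-batch noise, weighted
by `ρ`, sums to an L²-bounded martingale, hence converges, and the drift of the gradient per unit of
`ρ` vanishes (`ae_tendsto_average_sub`). What remains is a deterministic ascent method with
vanishing error: near a non-stationary cluster point each step raises the objective `f` by at least
`η * ω`.

Local ascent alone does not make every cluster point stationary, since the sequence might oscillate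
between stationary sets at different levels. This is excluded because `f` takes only countably many
values on stationary points. The objective is a polynomial, a stationary point is a critical point
of `f` restricted to the affine hull of its face, there are finitely many faces, and an analytic
function has countably many critical values (`countable_criticalValues`). Levels avoiding these
values are dense and eventually never crossed downwards, so `f` converges along the iterates. A
non-stationary cluster point would then trap the sequence in a ball where `f` grows without bound
(`mem_of_mapClusterPt_of_ascent`).

The choice of maximisers in a run need not be measurable. Uniqueness of the maximisers identifies
the run with `selectedRun`, a function of the initial preambles and the batch indices, to which the
martingale argument applies. -/

noncomputable section

namespace RandomAccess

/-! ### Countability of the critical values of an analytic function -/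

section CriticalValues

open scoped ContDiff

/-- A zero set of an analytic function is, near a regular point, parametrised analytically by the
kernel of the derivative. -/
theorem exists_analyticAt_parametrization {E : Type*} [NormedAddCommGroup E] [NormedSpace ℝ E]
    [FiniteDimensional ℝ E] {w : E → ℝ} {q : E} (hw : AnalyticAt ℝ w q) (hq : w q = 0)
    (hd : fderiv ℝ w q ≠ 0) :
    ∃ (ψ : (fderiv ℝ w q).ker → E) (π : E → (fderiv ℝ w q).ker),
      ∀ᶠ x in 𝓝 q, w x = 0 → AnalyticAt ℝ ψ (π x) ∧ ψ (π x) = x := by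
  have : CompleteSpace E := FiniteDimensional.complete ℝ E
  have hsurj : (fderiv ℝ w q).range = ⊤ := by
    have hne : ∃ v, fderiv ℝ w q v ≠ 0 := by
      by_contra! h
      exact hd (ContinuousLinearMap.ext h)
    obtain ⟨v, hv⟩ := hne
    refine LinearMap.range_eq_top.2 fun r => ⟨(r / fderiv ℝ w q v) • v, ?_⟩
    simp [hv]
  have hker : (fderiv ℝ w q).ker.ClosedComplemented :=
    ContinuousLinearMap.ker_closedComplemented_of_finiteDimensional_range _
  -- Near `q`, the value of `w` and a linear projection to the kernel form analytic coordinates; `ψ`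
  -- is the slice where the first coordinate is `0`.
  set φ := HasStrictFDerivAt.implicitFunctionDataOfComplemented w (fderiv ℝ w q)
    hw.hasStrictFDerivAt hsurj hker with hφ
  have hcw : ContDiffAt ℝ ω w q := hw.contDiffAt
  have hlf : φ.leftFun = w := rfl
  have hpt : φ.pt = q := rfl
  have hrf : ContDiffAt ℝ ω φ.rightFun q := by
    have : φ.rightFun = fun x => Classical.choose hker (x - q) := rfl
    rw [this]
    fun_prop
  have hc : ContDiffAt ℝ ω φ.implicitFunction.uncurry (φ.prodFun φ.pt) :=
    φ.contDiffAt_implicitFunction hcw hrf (by simp)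
  have hψ : ContDiffAt ℝ ω (fun y => φ.implicitFunction 0 y) (φ.rightFun q) := by
    have h1 : φ.prodFun φ.pt = (0, φ.rightFun q) := by
      rw [φ.prodFun_apply, hpt, hlf, hq]
    rw [h1] at hc
    exact hc.comp (φ.rightFun q) (contDiffAt_const.prodMk contDiffAt_id)
  have han := hψ.analyticAt.eventually_analyticAt
  refine ⟨fun y => φ.implicitFunction 0 y, φ.rightFun, ?_⟩
  have h3 := φ.implicitFunction_apply_image
  rw [hpt] at h3
  filter_upwards [hrf.continuousAt.eventually han, h3] with x hx1 hx2 hwx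
  refine ⟨hx1, ?_⟩
  rw [hlf, hwx] at hx2
  exact hx2

/-- Lindelöf property: countably many of the local pieces already cover `s`. -/
theorem countable_image_of_forall_mem_nhdsWithin {X Y : Type*} [TopologicalSpace X]
    [SecondCountableTopology X] {f : X → Y} {s : Set X}
    (h : ∀ x ∈ s, ∃ t ∈ 𝓝[s] x, (f '' t).Countable) : (f '' s).Countable := by
  choose! t ht hc using h
  obtain ⟨u, hus, huc, hsu⟩ := TopologicalSpace.countable_cover_nhdsWithin ht
  refine Set.Countable.mono (Set.image_mono hsu) ?_
  rw [Set.image_iUnion₂]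
  exact huc.biUnion fun x hx => hc x (hus hx)

theorem eventually_eq_of_iteratedFDeriv_eq_zero {E : Type*} [NormedAddCommGroup E]
    [NormedSpace ℝ E] {f : E → ℝ} {q : E} (hf : AnalyticAt ℝ f q)
    (h : ∀ k, iteratedFDeriv ℝ (k + 1) f q = 0) : ∀ᶠ x in 𝓝 q, f x = f q := by
  obtain ⟨p, r, hp⟩ := hf
  filter_upwards [Metric.eball_mem_nhds q hp.r_pos] with x hx
  have hy : x - q ∈ Metric.eball (0 : E) r := by
    simpa [Metric.mem_eball, edist_eq_enorm_sub] using hx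
  have hs := hp.hasSum_iteratedFDeriv hy
  have hs' := hasSum_single (f := fun n : ℕ => ((n.factorial : ℝ)⁻¹) •
      iteratedFDeriv ℝ n f q fun _ => x - q) 0 (by
    intro n hn
    obtain ⟨k, rfl⟩ := Nat.exists_eq_succ_of_ne_zero hn
    simp [h k])
  have := hs.unique hs'
  simpa using this

/-- **Sard's theorem for analytic functions**: a real analytic function on a finite-dimensional
space has at most countably many critical values. -/
theorem countable_criticalValues_of_finrank (n : ℕ) :
    ∀ (E : Type*) [NormedAddCommGroup E] [NormedSpace ℝ E] [FiniteDimensional ℝ E],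
      Module.finrank ℝ E = n → ∀ f : E → ℝ,
        (f '' {x | AnalyticAt ℝ f x ∧ fderiv ℝ f x = 0}).Countable := by
  induction n using Nat.strong_induction_on with
  | _ n ih =>
  intro E _ _ _ hn f
  have : ProperSpace E := FiniteDimensional.proper_real E
  -- On `C` the function is locally constant. Near a point of `S k`, a component of the derivative
  -- of order `k + 1` cuts out a hypersurface containing `S k`, and the dimension drops.
  set C : Set E := {x | AnalyticAt ℝ f x ∧ ∀ k, iteratedFDeriv ℝ (k + 1) f x = 0}
  set S : ℕ → Set E := fun k => {x | AnalyticAt ℝ f x ∧ fderiv ℝ f x = 0 ∧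
    iteratedFDeriv ℝ (k + 1) f x = 0 ∧ iteratedFDeriv ℝ (k + 2) f x ≠ 0}
  have hcover : {x | AnalyticAt ℝ f x ∧ fderiv ℝ f x = 0} ⊆ C ∪ ⋃ k, S k := by
    rintro x ⟨hx, hdx⟩
    by_cases hall : ∀ k, iteratedFDeriv ℝ (k + 1) f x = 0
    · exact Or.inl ⟨hx, hall⟩
    · classical
      push Not at hall
      right
      have h1 : iteratedFDeriv ℝ (0 + 1) f x = 0 := by
        change iteratedFDeriv ℝ 1 f x = 0
        ext v
        rw [iteratedFDeriv_one_apply, hdx]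
        rfl
      obtain ⟨k, hk⟩ : ∃ k, Nat.find hall = k + 1 := by
        refine Nat.exists_eq_succ_of_ne_zero fun h0 => ?_
        have := Nat.find_spec hall
        rw [h0] at this
        exact this h1
      have hk1 := Nat.find_spec hall
      rw [hk] at hk1
      have hk2 := Nat.find_min hall (m := k) (by omega)
      exact Set.mem_iUnion.2 ⟨k, hx, hdx, not_not.1 hk2, hk1⟩
  refine Set.Countable.mono (Set.image_mono hcover) ?_
  rw [Set.image_union, Set.image_iUnion]
  refine Set.Countable.union ?_ (Set.countable_iUnion fun k => ?_)
  · refine countable_image_of_forall_mem_nhdsWithin fun q hq => ?_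
    refine ⟨{x | f x = f q},
      mem_nhdsWithin_of_mem_nhds (eventually_eq_of_iteratedFDeriv_eq_zero hq.1 hq.2), ?_⟩
    refine (Set.countable_singleton (f q)).mono ?_
    rintro _ ⟨x, hx, rfl⟩
    exact hx
  · refine countable_image_of_forall_mem_nhdsWithin fun q hq => ?_
    obtain ⟨hfq, hdq, hq1, hq2⟩ := hq
    obtain ⟨v, hv⟩ : ∃ v, iteratedFDeriv ℝ (k + 2) f q v ≠ 0 := by
      by_contra! h
      exact hq2 (ContinuousMultilinearMap.ext h)
    -- The derivative of `w` at `q` in direction `v 0` is the nonzero value in `hv`, so `q` is a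
    -- regular point of the zero set of `w`.
    set w : E → ℝ := fun x => iteratedFDeriv ℝ (k + 1) f x (Fin.tail v) with hw
    have hitan : AnalyticAt ℝ (iteratedFDeriv ℝ (k + 1) f) q := 
      (hfq.contDiffAt (n := ω)).iteratedFDeriv_right (m := ω) (i := k + 1) le_top |>.analyticAt
    have hwan : AnalyticAt ℝ w q :=
      ((ContinuousMultilinearMap.apply ℝ (fun _ : Fin (k + 1) => E) ℝ
        (Fin.tail v)).analyticAt _).comp hitan
    have hwq : w q = 0 := by simp [hw, hq1]
    have hdw : fderiv ℝ w q ≠ 0 := by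
      intro h0
      apply hv
      rw [iteratedFDeriv_succ_apply_left]
      have h1 : fderiv ℝ w q = (ContinuousMultilinearMap.apply ℝ (fun _ : Fin (k + 1) => E) ℝ
          (Fin.tail v)).comp (fderiv ℝ (iteratedFDeriv ℝ (k + 1) f) q) :=
        ((ContinuousMultilinearMap.apply ℝ (fun _ : Fin (k + 1) => E) ℝ
          (Fin.tail v)).hasFDerivAt.comp q hitan.differentiableAt.hasFDerivAt).fderiv
      have h2 := congrArg (fun L => L (v 0)) h1
      rw [h0] at h2
      simpa using h2.symm
    obtain ⟨ψ, π, hψ⟩ := exists_analyticAt_parametrization hwan hwq hdw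
    have hlt : Module.finrank ℝ (fderiv ℝ w q).ker < n := by
      rw [← hn]
      refine Submodule.finrank_lt fun htop => hdw ?_
      ext x
      have : x ∈ (fderiv ℝ w q).ker := by rw [htop]; trivial
      simpa using this
    refine ⟨{x | w x = 0 → AnalyticAt ℝ ψ (π x) ∧ ψ (π x) = x} ∩ S k,
      inter_mem (mem_nhdsWithin_of_mem_nhds hψ) self_mem_nhdsWithin, ?_⟩
    -- By the chain rule, points of `S k` near `q` are images under `ψ` of critical points of `f ∘
    -- ψ`.
    refine (ih _ hlt _ rfl (f ∘ ψ)).mono ?_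
    rintro _ ⟨x, ⟨hx1, hx2, hx3, hx4, -⟩, rfl⟩
    obtain ⟨ha, hb⟩ := hx1 (by simp [hw, hx4])
    refine ⟨π x, ⟨?_, ?_⟩, by simp [hb]⟩
    · exact AnalyticAt.comp (by rwa [hb]) ha
    · rw [fderiv_comp _ (by rw [hb]; exact hx2.differentiableAt) ha.differentiableAt, hb, hx3]
      simp

theorem countable_criticalValues {E : Type*} [NormedAddCommGroup E] [NormedSpace ℝ E]
    [FiniteDimensional ℝ E] (f : E → ℝ) :
    (f '' {x | AnalyticAt ℝ f x ∧ fderiv ℝ f x = 0}).Countable :=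
  countable_criticalValues_of_finrank _ E rfl f

end CriticalValues

/-! ### Deterministic recursions and ascent sequences -/

section Deterministic

/-- Once `β` is below `a / 2`, the excess of `u` over `a / 2` shrinks by `1 - r ≤ exp (-r)` per
step, and these factors multiply to `0` because the sum of `r` diverges. -/
theorem tendsto_zero_of_le_convexCombination {u r β : ℕ → ℝ} (hu : ∀ t, 0 ≤ u t)
    (hr : ∀ᶠ t in atTop, 0 ≤ r t ∧ r t ≤ 1)
    (hsum : Tendsto (fun T => ∑ t ∈ Finset.range T, r t) atTop atTop)
    (hβ : Tendsto β atTop (𝓝 0))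
    (h : ∀ᶠ t in atTop, u (t + 1) ≤ (1 - r t) * u t + r t * β t) :
    Tendsto u atTop (𝓝 0) := by
  rw [tendsto_order]
  refine ⟨fun a ha => Eventually.of_forall fun t => ha.trans_le (hu t), fun a ha => ?_⟩
  have hβ' : ∀ᶠ t in atTop, β t < a / 2 := (tendsto_order.1 hβ).2 _ (by linarith)
  obtain ⟨T, hT⟩ := eventually_atTop.1 (hr.and (h.and hβ'))
  set σ : ℕ → ℝ := fun T => ∑ t ∈ Finset.range T, r t with hσ
  have key : ∀ t, T ≤ t → u t - a / 2 ≤ |u T - a / 2| * Real.exp (-(σ t - σ T)) := by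
    intro t ht
    induction t, ht using Nat.le_induction with
    | base => simpa using le_abs_self (u T - a / 2)
    | succ t ht ih =>
      obtain ⟨⟨h0, h1⟩, h2, h3⟩ := hT t ht
      have hs : σ (t + 1) = σ t + r t := Finset.sum_range_succ _ _
      have he : Real.exp (-(σ (t + 1) - σ T)) = Real.exp (-r t) * Real.exp (-(σ t - σ T)) := by
        rw [← Real.exp_add, hs]
        ring_nf
      have hle : 1 - r t ≤ Real.exp (-r t) := by
        have := Real.add_one_le_exp (-r t)
        linarith
      calc u (t + 1) - a / 2 ≤ (1 - r t) * (u t - a / 2) := by nlinarith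
        _ ≤ (1 - r t) * (|u T - a / 2| * Real.exp (-(σ t - σ T))) :=
            mul_le_mul_of_nonneg_left ih (by linarith)
        _ ≤ Real.exp (-r t) * (|u T - a / 2| * Real.exp (-(σ t - σ T))) :=
            mul_le_mul_of_nonneg_right hle (by positivity)
        _ = |u T - a / 2| * Real.exp (-(σ (t + 1) - σ T)) := by rw [he]; ring
  have hexp : Tendsto (fun t => |u T - a / 2| * Real.exp (-(σ t - σ T))) atTop (𝓝 0) := by
    have h1 : Tendsto (fun t => σ t - σ T) atTop atTop :=
      by
      simpa [sub_eq_add_neg] using tendsto_atTop_add_const_right atTop (-σ T) hsum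
    simpa using (Real.tendsto_exp_neg_atTop_nhds_zero.comp h1).const_mul |u T - a / 2|
  filter_upwards [(tendsto_order.1 hexp).2 (a / 2) (by linarith), eventually_ge_atTop T]
    with t h1 h2
  linarith [key t h2]

theorem tendsto_zero_of_eq_convexCombination {u r β : ℕ → ℝ}
    (hr : ∀ᶠ t in atTop, 0 ≤ r t ∧ r t ≤ 1)
    (hsum : Tendsto (fun T => ∑ t ∈ Finset.range T, r t) atTop atTop)
    (hβ : Tendsto β atTop (𝓝 0))
    (h : ∀ t, u (t + 1) = (1 - r t) * u t + r t * β t) :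
    Tendsto u atTop (𝓝 0) := by
  rw [tendsto_zero_iff_abs_tendsto_zero] at hβ ⊢
  refine tendsto_zero_of_le_convexCombination (fun _ => abs_nonneg _) hr hsum hβ ?_
  filter_upwards [hr] with t ht
  simp only [Function.comp]
  rw [h t]
  refine (abs_add_le _ _).trans_eq ?_
  rw [abs_mul, abs_mul, abs_of_nonneg ht.1, abs_of_nonneg (sub_nonneg.2 ht.2)]

/-- A sequence with vanishing steps which increases `f` near each of its cluster points outside
`S` only clusters in `S`, provided that `f '' S` is countable. -/
theorem mem_of_mapClusterPt_of_ascent {E : Type*} [MetricSpace E] {B S : Set E}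
    (hB : IsCompact B) {z : ℕ → E} (hz : ∀ t, z t ∈ B) {f : E → ℝ} (hf : Continuous f)
    (hS : (f '' S).Countable) {r : ℕ → ℝ} {D : ℝ} (hr : ∀ t, 0 < r t)
    (hr0 : Tendsto r atTop (𝓝 0))
    (hsum : Tendsto (fun T => ∑ t ∈ Finset.range T, r t) atTop atTop)
    (hstep : ∀ t, dist (z (t + 1)) (z t) ≤ D * r t)
    (hasc : ∀ y, MapClusterPt y atTop z → y ∉ S → ∃ η > 0, ∃ U ∈ 𝓝 y,
      ∀ᶠ t in atTop, z t ∈ U → f (z t) + η * r t ≤ f (z (t + 1)))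
    {y : E} (hy : MapClusterPt y atTop z) : y ∈ S := by
  have hD : 0 ≤ D := by
    have h1 := dist_nonneg.trans (hstep 0)
    exact le_of_not_gt fun h => by nlinarith [hr 0]
  have hdist : Tendsto (fun t => dist (z (t + 1)) (z t)) atTop (𝓝 0) :=
    squeeze_zero (fun _ => dist_nonneg) hstep (by simpa using hr0.const_mul D)
  have hfd : Tendsto (fun t => f (z (t + 1)) - f (z t)) atTop (𝓝 0) := by
    have huc := hB.uniformContinuousOn_of_continuous hf.continuousOn
    rw [Metric.uniformContinuousOn_iff] at huc
    rw [Metric.tendsto_atTop]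
    intro e he
    obtain ⟨δ, hδ, hδ'⟩ := huc e he
    obtain ⟨T, hT⟩ := eventually_atTop.1 ((tendsto_order.1 hdist).2 δ hδ)
    refine ⟨T, fun t ht => ?_⟩
    have := hδ' _ (hz (t + 1)) _ (hz t) (hT t ht)
    simpa [Real.dist_eq] using this
  -- Otherwise the times of downward crossings of `c` would have a cluster point at level exactly
  -- `c`, hence outside `S`, where steps increase `f`.
  have hlevel : ∀ c, c ∉ f '' S → ∀ᶠ t in atTop, c ≤ f (z t) → c ≤ f (z (t + 1)) := by
    intro c hc
    by_contra hcon
    have hfr : ∃ᶠ t in atTop, c ≤ f (z t) ∧ f (z (t + 1)) < c :=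
      (not_eventually.1 hcon).mono fun t ht => by push Not at ht; exact ht
    set P : Set ℕ := {t | c ≤ f (z t) ∧ f (z (t + 1)) < c}
    have hne : NeBot (atTop ⊓ 𝓟 P) := frequently_mem_iff_neBot.1 hfr
    have hev : ∀ᶠ t in atTop ⊓ 𝓟 P, c ≤ f (z t) ∧ f (z (t + 1)) < c :=
      mem_inf_of_right (mem_principal_self P)
    obtain ⟨y, -, hy⟩ := hB.exists_mapClusterPt_of_frequently (f := z) (l := atTop ⊓ 𝓟 P)
      (Eventually.of_forall hz).frequently
    have hlim : Tendsto (fun t => f (z t)) (atTop ⊓ 𝓟 P) (𝓝 c) := by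
      have h1 : Tendsto (fun t => c - (f (z (t + 1)) - f (z t))) (atTop ⊓ 𝓟 P) (𝓝 c) := by
        simpa using (hfd.mono_left inf_le_left).const_sub c
      refine tendsto_of_tendsto_of_tendsto_of_le_of_le' tendsto_const_nhds h1 ?_ ?_
      · exact hev.mono fun t ht => ht.1
      · exact hev.mono fun t ht => by linarith [ht.2]
    have hfy : f y = c := by
      have h2 : MapClusterPt (f y) (atTop ⊓ 𝓟 P) (f ∘ z) := hy.continuousAt_comp hf.continuousAt
      have h3 : NeBot (𝓝 (f y) ⊓ 𝓝 c) := NeBot.mono h2 (inf_le_inf_left _ hlim)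
      exact eq_of_nhds_neBot h3
    have hyS : y ∉ S := fun h => hc ⟨y, h, hfy⟩
    obtain ⟨η, hη, U, hU, hUt⟩ := hasc y (hy.mono inf_le_left) hyS
    obtain ⟨t, ht1, ht2, ht3, ht4⟩ := ((hy.frequently hU).and_eventually
      ((hUt.filter_mono inf_le_left).and hev)).exists
    have := ht2 ht1
    have := mul_pos hη (hr t)
    linarith
  obtain ⟨L, hL⟩ : ∃ L, Tendsto (fun t => f (z t)) atTop (𝓝 L) := by
    have hbdd := (hB.image hf).isBounded
    have hrange : Set.range (fun t => f (z t)) ⊆ f '' B := by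
      rintro _ ⟨t, rfl⟩
      exact ⟨z t, hz t, rfl⟩
    refine tendsto_of_no_upcrossings (s := (f '' S)ᶜ) (hS.dense_compl ℝ) ?_
      (hbdd.subset hrange).bddAbove.isBoundedUnder_of_range
      (hbdd.subset hrange).bddBelow.isBoundedUnder_of_range
    rintro a ha b hb hab ⟨h1, h2⟩
    obtain ⟨T, hT⟩ := eventually_atTop.1 (hlevel b hb)
    obtain ⟨t₀, ht₀, hbt⟩ := frequently_atTop.1 h2 T
    have hstay : ∀ t, t₀ ≤ t → b ≤ f (z t) := by
      intro t ht
      induction t, ht using Nat.le_induction with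
      | base => exact hbt.le
      | succ t ht ih => exact hT t (ht₀.trans ht) ih
    obtain ⟨t, ht, hta⟩ := frequently_atTop.1 h1 t₀
    linarith [hstay t ht]
  by_contra hyS
  obtain ⟨η, hη, U, hU, hUt⟩ := hasc y hy hyS
  obtain ⟨R, hR, hRU⟩ := Metric.mem_nhds_iff.1 hU
  -- Chosen so that a gain of at most `κ` limits the distance travelled to `R / 2`: starting within
  -- `R / 2` of `y`, the sequence never leaves the ball. The denominator `D + 1` allows `D = 0`.
  set κ : ℝ := η * (R / 2) / (D + 1) with hκ
  have hκ0 : 0 < κ := by positivity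
  obtain ⟨T₁, hT₁⟩ := Metric.cauchySeq_iff.1 hL.cauchySeq κ hκ0
  obtain ⟨T₂, hT₂⟩ := eventually_atTop.1 hUt
  obtain ⟨t₀, ht₀, hyt⟩ := frequently_atTop.1
    (hy.frequently (Metric.ball_mem_nhds y (half_pos hR))) (max T₁ T₂)
  set σ : ℕ → ℝ := fun T => ∑ t ∈ Finset.range T, r t with hσ
  have hbound : ∀ x, f (z t₀) + η * x ≤ f (z t₀) + κ → D * x ≤ R / 2 := by
    intro x hx
    have hx' : x ≤ R / 2 / (D + 1) := by
      have : η * x ≤ η * (R / 2 / (D + 1)) := by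
        rw [hκ] at hx
        rw [← mul_div_assoc]
        linarith
      exact le_of_mul_le_mul_left this hη
    calc D * x ≤ D * (R / 2 / (D + 1)) := mul_le_mul_of_nonneg_left hx' hD
      _ = (D / (D + 1)) * (R / 2) := by ring
      _ ≤ 1 * (R / 2) := by
          gcongr
          rw [div_le_one (by positivity)]
          linarith
      _ = R / 2 := one_mul _
  have hmain : ∀ t, t₀ ≤ t → dist (z t) (z t₀) ≤ D * (σ t - σ t₀) ∧
      f (z t₀) + η * (σ t - σ t₀) ≤ f (z t) := by
    intro t ht
    induction t, ht using Nat.le_induction with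
    | base => simp
    | succ t ht ih =>
      have hs : σ (t + 1) = σ t + r t := Finset.sum_range_succ _ _
      have hcl := hT₁ t ((le_max_left _ _).trans (ht₀.trans ht)) t₀ ((le_max_left _ _).trans ht₀)
      rw [Real.dist_eq] at hcl
      have h1 := (abs_lt.1 hcl).2
      have h2 := hbound (σ t - σ t₀) (by linarith [ih.2])
      have h3 : z t ∈ U := hRU (by
        change dist (z t) y < R
        change dist (z t₀) y < R / 2 at hyt
        linarith [dist_triangle (z t) (z t₀) y, ih.1])
      have h4 := hT₂ t ((le_max_right _ _).trans (ht₀.trans ht)) h3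
      constructor
      · rw [hs]
        linarith [dist_triangle (z (t + 1)) (z t) (z t₀), ih.1, hstep t]
      · rw [hs]
        linarith [ih.2]
  have hσ' : Tendsto (fun t => σ t) atTop atTop := hsum
  -- Trapped in the ball, `f` gains more than `κ` since the step sizes sum to infinity, against the
  -- Cauchy bound.
  obtain ⟨t, ht1, ht2⟩ := ((hσ'.eventually_gt_atTop (σ t₀ + κ / η)).and
    (eventually_ge_atTop t₀)).exists
  have hcl := hT₁ t ((le_max_left _ _).trans (ht₀.trans ht2)) t₀ ((le_max_left _ _).trans ht₀)
  rw [Real.dist_eq] at hcl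
  have h1 := (abs_lt.1 hcl).2
  have h2 := (hmain t ht2).2
  have h3 : η * (κ / η) < η * (σ t - σ t₀) := mul_lt_mul_of_pos_left (by linarith) hη
  rw [mul_div_cancel₀ _ hη.ne'] at h3
  linarith

end Deterministic

/-! ### Martingale noise and tracking by recursive averages -/

section StochasticApproximation

/-- The filtration generated by the mini-batch indices. -/
def historyFiltration {Ω : Type*} {mΩ : MeasurableSpace Ω} {M : ℕ} (ξ : ℕ → Ω → Fin M)
    (hξ : ∀ t, Measurable (ξ t)) : Filtration ℕ mΩ where
  seq t := ⨆ s ∈ {s : ℕ | s ≤ t}, MeasurableSpace.comap (ξ s) inferInstance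
  mono' _ _ hij := biSup_mono fun _ hk => le_trans hk hij
  le' _ := iSup₂_le fun s _ => (hξ s).comap_le

variable {Ω : Type*} {mΩ : MeasurableSpace Ω} {M : ℕ} {ξ : ℕ → Ω → Fin M}

theorem measurable_historyFiltration (hξ : ∀ t, Measurable (ξ t)) {s t : ℕ} (hst : s ≤ t) :
    Measurable[historyFiltration ξ hξ t] (ξ s) := by
  have h : MeasurableSpace.comap (ξ s) inferInstance ≤ historyFiltration ξ hξ t :=
    le_iSup₂_of_le (f := fun s (_ : s ∈ {s : ℕ | s ≤ t}) =>
      MeasurableSpace.comap (ξ s) inferInstance) s hst le_rfl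
  exact Measurable.mono (comap_measurable (ξ s)) h le_rfl

/-- The history up to time `t` takes values in a finite discrete space, on which every function is
measurable, including those built from chosen maximisers. -/
theorem measurable_of_dependsOn_history (hξ : ∀ t, Measurable (ξ t)) {X : Type*}
    [MeasurableSpace X] {t : ℕ} {F : (ℕ → Fin M) → X}
    (hF : ∀ p q, (∀ s ≤ t, p s = q s) → F p = F q) :
    Measurable[historyFiltration ξ hξ t] (fun w => F (fun s => ξ s w)) := by
  let F' : (Fin (t + 1) → Fin M) → X := fun p =>
    F (fun s => p ⟨min s t, Nat.lt_succ_of_le (min_le_right s t)⟩)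
  have hF' : Measurable F' := Measurable.of_discrete
  have hr : Measurable[historyFiltration ξ hξ t] (fun w (s : Fin (t + 1)) => ξ s w) :=
    @measurable_pi_lambda _ _ _ (historyFiltration ξ hξ t) _ _
      fun s => measurable_historyFiltration hξ (Nat.le_of_lt_succ s.2)
  have heq : (fun w => F (fun s => ξ s w)) = F' ∘ fun w (s : Fin (t + 1)) => ξ s w := by
    funext w
    exact hF _ _ fun s hs => by simp [min_eq_left hs]
  rw [heq]
  exact hF'.comp hr

theorem indep_comap_historyFiltration {P : Measure Ω} (hξ : ∀ t, Measurable (ξ t))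
    (hind : iIndepFun ξ P) (t : ℕ) :
    Indep (historyFiltration ξ hξ t) (MeasurableSpace.comap (ξ (t + 1)) inferInstance) P := by
  have h := indep_iSup_of_disjoint (S := {k | k ≤ t}) (T := {t + 1})
    (fun k => (hξ k).comap_le) hind (by simp)
  rw [iSup_singleton] at h
  exact h

variable {P : Measure Ω} [IsProbabilityMeasure P]

/-- A centred function of the next mini-batch index, whose coefficients depend on the past, has
zero mean. -/
theorem integral_eq_zero_of_sum_eq_zero (hξ : ∀ t, Measurable (ξ t))
    (hunif : ∀ t m, P (ξ t ⁻¹' {m}) = (M : ℝ≥0∞)⁻¹) (hind : iIndepFun ξ P) {t : ℕ}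
    {φ : Ω → Fin M → ℝ} (hφ : ∀ m, Measurable[historyFiltration ξ hξ t] (fun w => φ w m))
    {C : ℝ} (hC : ∀ w m, |φ w m| ≤ C) (h0 : ∀ w, ∑ m, φ w m = 0) :
    ∫ w, φ w (ξ (t + 1) w) ∂P = 0 := by
  have hle := (historyFiltration ξ hξ).le t
  have hφ' : ∀ m, Measurable (fun w => φ w m) := fun m => (hφ m).mono hle le_rfl
  have hint : ∀ m, Integrable (fun w => φ w m) P := fun m =>
    Integrable.of_bound (hφ' m).aestronglyMeasurable C (Eventually.of_forall fun w => hC w m)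
  set I : Fin M → Ω → ℝ := fun m => (ξ (t + 1) ⁻¹' {m}).indicator fun _ => 1
  have hms : ∀ m, MeasurableSet (ξ (t + 1) ⁻¹' {m}) := fun m =>
    hξ (t + 1) (measurableSet_singleton m)
  have hI : ∀ m, Measurable (I m) := fun m => measurable_const.indicator (hms m)
  have hIc : ∀ m, Measurable[MeasurableSpace.comap (ξ (t + 1)) inferInstance] (I m) := fun m =>
    Measurable.indicator (m := MeasurableSpace.comap (ξ (t + 1)) inferInstance)
      measurable_const ⟨{m}, measurableSet_singleton m, rfl⟩
  -- Each indicator of `ξ (t + 1) = m` is independent of the past with mean `1 / M`, so the mean of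
  -- the whole is that of `(∑ m, φ w m) / M`.
  have hexp : ∀ w, φ w (ξ (t + 1) w) = ∑ m, φ w m * I m w := by
    intro w
    rw [Finset.sum_eq_single (ξ (t + 1) w)]
    · simp [I]
    · intro m _ hm
      have : w ∉ ξ (t + 1) ⁻¹' {m} := fun h => hm h.symm
      simp [I, Set.indicator_of_notMem this]
    · simp
  have hindep : ∀ m, IndepFun (fun w => φ w m) (I m) P := by
    intro m
    rw [IndepFun_iff_Indep]
    exact indep_of_indep_of_le_left (indep_of_indep_of_le_right
      (indep_comap_historyFiltration hξ hind t) (hIc m).comap_le) (hφ m).comap_le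
  have hIint : ∀ m, ∫ w, I m w ∂P = (M : ℝ)⁻¹ := by
    intro m
    rw [integral_indicator_const _ (hms m)]
    simp [Measure.real, hunif]
  have hmul : ∀ m, Integrable (fun w => φ w m * I m w) P := by
    intro m
    refine Integrable.of_bound ((hφ' m).mul (hI m)).aestronglyMeasurable C
      (Eventually.of_forall fun w => ?_)
    by_cases hw : w ∈ ξ (t + 1) ⁻¹' {m}
    · simpa [I, Set.indicator_of_mem hw] using hC w m
    · simpa [I, Set.indicator_of_notMem hw] using (abs_nonneg _).trans (hC w m)
  simp_rw [hexp]
  rw [integral_finsetSum _ fun m _ => hmul m]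
  have : ∀ m, ∫ w, φ w m * I m w ∂P = (∫ w, φ w m ∂P) * (M : ℝ)⁻¹ := by
    intro m
    rw [(hindep m).integral_fun_mul_eq_mul_integral (hφ' m).aestronglyMeasurable
      (hI m).aestronglyMeasurable, hIint]
  simp_rw [this]
  rw [← Finset.sum_mul, ← integral_finsetSum _ fun m _ => hint m]
  simp [h0]

/-- The partial sums form a martingale with orthogonal increments, so their second moments are
bounded by the sum of `b t ^ 2`; Doob's convergence theorem applies. -/
theorem ae_exists_tendsto_sum_of_centred (hξ : ∀ t, Measurable (ξ t))
    (hunif : ∀ t m, P (ξ t ⁻¹' {m}) = (M : ℝ≥0∞)⁻¹) (hind : iIndepFun ξ P)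
    {φ : ℕ → (ℕ → Fin M) → Fin M → ℝ}
    (hφ : ∀ t p q, (∀ s ≤ t, p s = q s) → φ t p = φ t q)
    {b : ℕ → ℝ} (hb : ∀ t p m, |φ t p m| ≤ b t) (hsum : Summable fun t => b t ^ 2)
    (h0 : ∀ t p, ∑ m, φ t p m = 0) :
    ∀ᵐ w ∂P, ∃ L, Tendsto
      (fun T => ∑ t ∈ Finset.range T, φ t (fun s => ξ s w) (ξ (t + 1) w)) atTop (𝓝 L) := by
  set F : ℕ → (ℕ → Fin M) → ℝ := fun T p => ∑ t ∈ Finset.range T, φ t p (p (t + 1)) with hFdef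
  have hFdep : ∀ T p q, (∀ s ≤ T, p s = q s) → F T p = F T q := by
    intro T p q h
    refine Finset.sum_congr rfl fun t ht => ?_
    have htT := Finset.mem_range.1 ht
    rw [hφ t p q fun s hs => h s (by omega), h (t + 1) (by omega)]
  have hFsucc : ∀ T p, F (T + 1) p = F T p + φ T p (p (T + 1)) := fun T p =>
    Finset.sum_range_succ _ _
  have hFb : ∀ T p, |F T p| ≤ ∑ t ∈ Finset.range T, b t := fun T p =>
    (Finset.abs_sum_le_sum_abs _ _).trans (Finset.sum_le_sum fun t _ => hb _ _ _)
  set 𝓕 := historyFiltration ξ hξ with h𝓕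
  set S : ℕ → Ω → ℝ := fun T w => F T fun s => ξ s w with hSdef
  have hSm : ∀ T, Measurable[𝓕 T] (S T) := fun T => measurable_of_dependsOn_history hξ (hFdep T)
  have hSm' : ∀ T, Measurable (S T) := fun T => (hSm T).mono (𝓕.le T) le_rfl
  have hSint : ∀ T, Integrable (S T) P := fun T =>
    Integrable.of_bound (hSm' T).aestronglyMeasurable _ (Eventually.of_forall fun w => hFb T _)
  have hφm : ∀ t m, Measurable[𝓕 t] (fun w => φ t (fun s => ξ s w) m) := fun t m =>
    measurable_of_dependsOn_history hξ (F := fun p => φ t p m)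
      fun p q h => congrFun (hφ t p q h) m
  have hdint : ∀ t, Integrable (fun w => φ t (fun s => ξ s w) (ξ (t + 1) w)) P := by
    intro t
    have := (hSint (t + 1)).sub (hSint t)
    refine this.congr (Eventually.of_forall fun w => ?_)
    simp [hSdef, hFsucc]
  have hmart : Martingale S 𝓕 P := by
    refine martingale_of_setIntegral_eq_succ (fun T => (hSm T).stronglyMeasurable) hSint ?_
    intro T s hs
    have hs' : MeasurableSet s := 𝓕.le T s hs
    -- Multiplying by the indicator of an event of the past keeps the coefficients adapted and
    -- centred.
    have hz : ∫ w in s, φ T (fun r => ξ r w) (ξ (T + 1) w) ∂P = 0 := by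
      rw [← integral_indicator hs']
      have := integral_eq_zero_of_sum_eq_zero (P := P) hξ hunif hind (t := T)
        (φ := fun w m => s.indicator (fun w => φ T (fun r => ξ r w) m) w)
        (fun m => Measurable.indicator (m := 𝓕 T) (hφm T m) hs) (C := b T) ?_ ?_
      · rw [← this]
        congr 1
      · intro w m
        by_cases hw : w ∈ s
        · simpa [hw] using hb T _ m
        · simpa [hw] using (abs_nonneg _).trans (hb T (fun r => ξ r w) m)
      · intro w
        by_cases hw : w ∈ s <;> simp [hw, h0]
    have heq : ∫ w in s, S (T + 1) w ∂P
        = ∫ w in s, (S T w + φ T (fun r => ξ r w) (ξ (T + 1) w)) ∂P := by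
      simp only [hSdef, hFsucc]
    rw [heq, integral_add (hSint T).integrableOn (hdint T).integrableOn, hz, add_zero]
  have hS2int : ∀ T, Integrable (fun w => S T w ^ 2) P := fun T =>
    Integrable.of_bound ((hSm' T).pow_const 2).aestronglyMeasurable
      ((∑ t ∈ Finset.range T, b t) ^ 2) (Eventually.of_forall fun w => by
        rw [Real.norm_eq_abs, abs_pow]
        exact pow_le_pow_left₀ (abs_nonneg _) (hFb T _) 2)
  have hL2 : ∀ T, ∫ w, S T w ^ 2 ∂P ≤ ∑ t ∈ Finset.range T, b t ^ 2 := by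
    intro T
    induction T with
    | zero => simp [hSdef, hFdef]
    | succ T ih =>
      have hcross : ∫ w, S T w * φ T (fun r => ξ r w) (ξ (T + 1) w) ∂P = 0 := by
        refine integral_eq_zero_of_sum_eq_zero (P := P) hξ hunif hind (t := T)
          (φ := fun w m => S T w * φ T (fun r => ξ r w) m) (fun m => (hSm T).mul (hφm T m))
          (C := (∑ t ∈ Finset.range T, b t) * b T) ?_ ?_
        · intro w m
          rw [abs_mul]
          exact mul_le_mul (hFb T _) (hb T _ m) (abs_nonneg _)
            ((abs_nonneg _).trans (hFb T fun r => ξ r w))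
        · intro w
          rw [← Finset.mul_sum, h0, mul_zero]
      have hcint : Integrable (fun w => S T w * φ T (fun r => ξ r w) (ξ (T + 1) w)) P :=
        (hdint T).bdd_mul (hSm' T).aestronglyMeasurable
          (Eventually.of_forall fun w => hFb T fun r => ξ r w)
      have hle : ∫ w, S (T + 1) w ^ 2 ∂P ≤ ∫ w, (S T w ^ 2
          + 2 * (S T w * φ T (fun r => ξ r w) (ξ (T + 1) w)) + b T ^ 2) ∂P := by
        refine integral_mono (hS2int (T + 1))
          (((hS2int T).add (hcint.const_mul 2)).add (integrable_const _)) fun w => ?_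
        have h1 : φ T (fun r => ξ r w) (ξ (T + 1) w) ^ 2 ≤ b T ^ 2 :=
          sq_le_sq' (abs_le.1 (hb T _ _)).1 (abs_le.1 (hb T _ _)).2
        have h2 : S (T + 1) w = S T w + φ T (fun r => ξ r w) (ξ (T + 1) w) := hFsucc T _
        simp only [h2]
        nlinarith
      have hsint : Integrable (fun w => S T w ^ 2
          + 2 * (S T w * φ T (fun r => ξ r w) (ξ (T + 1) w))) P :=
        (hS2int T).add (hcint.const_mul 2)
      rw [integral_add hsint (integrable_const _),
        integral_add (hS2int T) (hcint.const_mul 2), integral_const_mul, hcross] at hle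
      rw [Finset.sum_range_succ]
      simp at hle
      linarith
  refine hmart.submartingale.exists_ae_tendsto_of_bdd
    (R := Real.toNNReal (1 + ∑' t, b t ^ 2)) fun T => ?_
  rw [eLpNorm_one_eq_lintegral_enorm, ← ofReal_integral_norm_eq_lintegral_enorm (hSint T)]
  refine ENNReal.ofReal_le_ofReal ?_
  calc ∫ w, ‖S T w‖ ∂P ≤ ∫ w, (1 + S T w ^ 2) ∂P := by
        refine integral_mono (hSint T).norm ((integrable_const _).add (hS2int T)) fun w => ?_
        simp only [Real.norm_eq_abs]
        rcases abs_cases (S T w) with h | h <;> nlinarith [sq_nonneg (S T w - 1/2),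
          sq_nonneg (S T w + 1/2)]
    _ = 1 + ∫ w, S T w ^ 2 ∂P := by
        rw [integral_add (integrable_const _) (hS2int T)]
        simp
    _ ≤ 1 + ∑' t, b t ^ 2 := by
        have := hsum.sum_le_tsum (Finset.range T) fun t _ => sq_nonneg (b t)
        linarith [hL2 T]

theorem IsDiminishingStepSize.tendsto_sum_range {s : ℕ → ℝ} (hs : IsDiminishingStepSize s) :
    Tendsto (fun T => ∑ t ∈ Finset.range T, s (t + 1)) atTop atTop := by
  refine hs.sum_eq_top.congr fun T => ?_
  rw [Finset.range_eq_Ico, Finset.sum_Ico_add' s 0 T 1]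
  rfl

theorem IsDiminishingStepSize.eventually_mem_Icc {s : ℕ → ℝ} (hs : IsDiminishingStepSize s) :
    ∀ᶠ t in atTop, 0 ≤ s (t + 1) ∧ s (t + 1) ≤ 1 := by
  have h := (hs.tendsto_zero.comp (tendsto_add_atTop_nat 1)).eventually_lt_const one_pos
  filter_upwards [h] with t ht
  exact ⟨(hs.pos (t + 1) (by omega)).le, ht.le⟩

/-- Recursive averages of mini-batch quantities `h m` along an adapted sequence `Z` which moves
more slowly than the averaging track the full-batch average of `h`. -/
theorem ae_tendsto_average_sub (hξ : ∀ t, Measurable (ξ t))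
    (hunif : ∀ t m, P (ξ t ⁻¹' {m}) = (M : ℝ≥0∞)⁻¹) (hind : iIndepFun ξ P)
    {ρ ω : ℕ → ℝ} (hρ : IsDiminishingStepSize ρ)
    (hωρ : Tendsto (fun t => ω t / ρ t) atTop (𝓝 0))
    {E : Type*} [PseudoMetricSpace E] {Z : ℕ → (ℕ → Fin M) → E}
    (hZ : ∀ t p q, (∀ s ≤ t, p s = q s) → Z t p = Z t q)
    {B : Set E} (hB : ∀ t p, Z t p ∈ B) {D : ℝ}
    (hstep : ∀ t p, dist (Z (t + 1) p) (Z t p) ≤ D * ω (t + 1))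
    {h : Fin M → E → ℝ} {C : ℝ} (hC : ∀ m, ∀ z ∈ B, |h m z| ≤ C)
    {L : ℝ} (hL0 : 0 ≤ L)
    (hL : ∀ y ∈ B, ∀ z ∈ B, |(M : ℝ)⁻¹ * ∑ m, h m y - (M : ℝ)⁻¹ * ∑ m, h m z| ≤ L * dist y z)
    {c : ℕ → (ℕ → Fin M) → ℝ}
    (hc : ∀ t p, c (t + 1) p = (1 - ρ (t + 1)) * c t p + ρ (t + 1) * h (p (t + 1)) (Z t p)) :
    ∀ᵐ w ∂P, Tendsto (fun t => c t (fun s => ξ s w)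
      - (M : ℝ)⁻¹ * ∑ m, h m (Z t fun s => ξ s w)) atTop (𝓝 0) := by
  rcases Nat.eq_zero_or_pos M with hM | hM
  · subst hM
    exact Eventually.of_forall fun w => (ξ 0 w).elim0
  set H : E → ℝ := fun z => (M : ℝ)⁻¹ * ∑ m, h m z with hH
  have hM' : (0 : ℝ) < M := Nat.cast_pos.2 hM
  have hHC : ∀ z ∈ B, |H z| ≤ C := by
    intro z hz
    have h1 : |∑ m, h m z| ≤ M * C := by
      refine (Finset.abs_sum_le_sum_abs _ _).trans
        ((Finset.sum_le_sum fun m _ => hC m z hz).trans_eq ?_)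
      simp
    rw [hH, abs_mul, abs_of_pos (inv_pos.2 hM'), inv_mul_le_iff₀ hM']
    exact h1
  have hconv := ae_exists_tendsto_sum_of_centred (P := P) hξ hunif hind
    (φ := fun t p m => ρ (t + 1) * (h m (Z t p) - H (Z t p)))
    (fun t p q hpq => by simp only [hZ t p q hpq])
    (b := fun t => ρ (t + 1) * (2 * C)) ?_ ?_ ?_
  · filter_upwards [hconv] with w hw
    obtain ⟨A, hA⟩ := hw
    set p : ℕ → Fin M := fun s => ξ s w with hp
    set S : ℕ → ℝ := fun T => ∑ t ∈ Finset.range T,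
      ρ (t + 1) * (h (p (t + 1)) (Z t p) - H (Z t p)) with hS
    have hA' : Tendsto S atTop (𝓝 A) := hA
    have hSsucc : ∀ T, S (T + 1) = S T + ρ (T + 1) * (h (p (T + 1)) (Z T p) - H (Z T p)) :=
      fun T => Finset.sum_range_succ _ _
    have hdrift : Tendsto (fun t => (H (Z t p) - H (Z (t + 1) p)) / ρ (t + 1)) atTop (𝓝 0) := by
      rw [tendsto_zero_iff_abs_tendsto_zero]
      have h1 : Tendsto (fun t => L * D * (ω (t + 1) / ρ (t + 1))) atTop (𝓝 0) := by
        simpa using (hωρ.comp (tendsto_add_atTop_nat 1)).const_mul (L * D)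
      refine squeeze_zero (fun _ => abs_nonneg _) (fun t => ?_) h1
      have hpos := hρ.pos (t + 1) (by omega)
      simp only [Function.comp]
      rw [abs_div, abs_of_pos hpos, ← mul_div_assoc]
      gcongr
      calc |H (Z t p) - H (Z (t + 1) p)| ≤ L * dist (Z t p) (Z (t + 1) p) :=
            hL _ (hB _ _) _ (hB _ _)
        _ ≤ L * (D * ω (t + 1)) := by
            rw [dist_comm]
            exact mul_le_mul_of_nonneg_left (hstep t p) hL0
        _ = L * D * ω (t + 1) := by ring
    have hβ : Tendsto (fun t => (A - S t) + (H (Z t p) - H (Z (t + 1) p)) / ρ (t + 1))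
        atTop (𝓝 0) := by
      simpa using (hA'.const_sub A).add hdrift
    -- Subtracting the remaining noise `S t - A` from the tracking error leaves a recursion forced
    -- only by `A - S t` and the drift of `H` divided by `ρ`, both of which vanish.
    have hu := tendsto_zero_of_eq_convexCombination
      (u := fun t => c t p - H (Z t p) - S t + A) hρ.eventually_mem_Icc hρ.tendsto_sum_range hβ
      (fun t => by
        have hpos := (hρ.pos (t + 1) (by omega)).ne'
        rw [hc, hSsucc]
        field_simp
        ring)
    have hlim := hu.add (hA'.sub_const A)
    simp only [sub_self, add_zero] at hlim
    refine hlim.congr fun t => ?_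
    ring
  · intro t p m
    have hpos := hρ.pos (t + 1) (by omega)
    rw [abs_mul, abs_of_pos hpos]
    refine mul_le_mul_of_nonneg_left ?_ hpos.le
    refine (abs_sub _ _).trans ?_
    linarith [hC m _ (hB t p), hHC _ (hB t p)]
  · simp_rw [mul_pow]
    exact hρ.sum_sq_lt_top.mul_right _
  · intro t p
    rw [← Finset.mul_sum, Finset.sum_sub_distrib]
    simp only [hH, Finset.sum_const, Finset.card_univ, Fintype.card_fin, nsmul_eq_mul]
    rw [mul_inv_cancel_left₀ hM'.ne', sub_self, mul_zero]

end StochasticApproximation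

/-! ### Derivative of the throughput form; Lipschitz and Taylor bounds -/

section Calculus

/-- For `y k = x k * A k n * ε` this is the throughput on one preamble. Exchanging the sum over
ordered pairs of distinct devices collects the coefficient of `y' k`, which is `g`. -/
theorem hasFDerivAt_sum_mul_prod_one_sub {E ι : Type*} [NormedAddCommGroup E] [NormedSpace ℝ E]
    [Fintype ι] [DecidableEq ι] {y : ι → E → ℝ} {y' : ι → E →L[ℝ] ℝ} {z : E}
    (hy : ∀ k, HasFDerivAt (y k) (y' k) z) :
    HasFDerivAt (fun z => ∑ k, y k z * ∏ l ∈ Finset.univ.erase k, (1 - y l z))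
      (∑ k, (∏ l ∈ Finset.univ.erase k, (1 - y l z) - ∑ l ∈ Finset.univ.erase k,
        y l z * ∏ j ∈ (Finset.univ.erase k).erase l, (1 - y j z)) • y' k) z := by
  have h1 : ∀ k, HasFDerivAt (fun z => y k z * ∏ l ∈ Finset.univ.erase k, (1 - y l z))
      (y k z • (∑ l ∈ Finset.univ.erase k,
        (∏ j ∈ (Finset.univ.erase k).erase l, (1 - y j z)) • (-y' l))
        + (∏ l ∈ Finset.univ.erase k, (1 - y l z)) • y' k) z := fun k =>
    (hy k).mul (HasFDerivAt.finsetProd fun l _ => by simpa using (hy l).const_sub 1)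
  refine (HasFDerivAt.fun_sum fun k (_ : k ∈ Finset.univ) => h1 k).congr_fderiv ?_
  ext v
  simp only [sum_apply, add_apply, smul_apply, neg_apply, smul_eq_mul, sub_mul,
    Finset.sum_add_distrib, Finset.sum_sub_distrib, Finset.sum_mul, Finset.mul_sum]
  rw [add_comm, sub_eq_add_neg, add_right_inj,
    Finset.sum_comm' (t' := Finset.univ) (s' := fun l => Finset.univ.erase l)
      (by intro a b; simp [eq_comm]), ← Finset.sum_neg_distrib]
  refine Finset.sum_congr rfl fun k _ => ?_
  rw [← Finset.sum_neg_distrib]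
  refine Finset.sum_congr rfl fun l _ => ?_
  rw [Finset.erase_right_comm]
  ring

theorem exists_lipschitz_bound_of_contDiff {E : Type*} [NormedAddCommGroup E] [NormedSpace ℝ E]
    [ProperSpace E] {F : Type*} [NormedAddCommGroup F] [NormedSpace ℝ F] {h : E → F}
    (hh : ContDiff ℝ 1 h) (R : ℝ) :
    ∃ L, 0 ≤ L ∧ ∀ y ∈ Metric.closedBall (0 : E) R, ∀ z ∈ Metric.closedBall (0 : E) R,
      ‖h y - h z‖ ≤ L * dist y z := by
  obtain ⟨L, hL⟩ := hh.locallyLipschitz.locallyLipschitzOn.exists_lipschitzOnWith_of_compact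
    (isCompact_closedBall (0 : E) R)
  exact ⟨L, L.2, fun y hy z hz => by simpa [dist_eq_norm] using hL.dist_le_mul y hy z hz⟩

/-- Mean value inequality on the segment from `z` to `y`, with a Lipschitz constant of the
derivative on the ball. -/
theorem exists_taylor_bound_of_contDiff {E : Type*} [NormedAddCommGroup E] [NormedSpace ℝ E]
    [ProperSpace E] {f : E → ℝ} (hf : ContDiff ℝ 2 f) (R : ℝ) :
    ∃ C, 0 ≤ C ∧ ∀ y ∈ Metric.closedBall (0 : E) R, ∀ z ∈ Metric.closedBall (0 : E) R,
      |f y - f z - fderiv ℝ f z (y - z)| ≤ C * dist y z ^ 2 := by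
  obtain ⟨L, hL0, hL⟩ := exists_lipschitz_bound_of_contDiff
    (hf.fderiv_right (m := 1) (by norm_num)) R
  refine ⟨L, hL0, fun y hy z hz => ?_⟩
  have hsub : segment ℝ z y ⊆ Metric.closedBall (0 : E) R :=
    (convex_closedBall _ _).segment_subset hz hy
  have := Convex.norm_image_sub_le_of_norm_hasFDerivWithin_le' (f := f) (f' := fderiv ℝ f)
    (φ := fderiv ℝ f z) (C := L * dist y z) (s := segment ℝ z y) (x := z) (y := y)
    (fun p _ => (hf.differentiable (by norm_num) p).hasFDerivAt.hasFDerivWithinAt)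
    (fun p hp => (hL p (hsub hp) z hz).trans (by
      refine mul_le_mul_of_nonneg_left ?_ hL0
      obtain ⟨θ, ⟨h0, h1⟩, rfl⟩ := (segment_eq_image' ℝ z y) ▸ hp
      rw [dist_eq_norm, dist_eq_norm, add_sub_cancel_left, norm_smul, Real.norm_of_nonneg h0]
      exact mul_le_of_le_one_left (norm_nonneg _) h1))
    (convex_segment z y) (left_mem_segment ℝ z y) (right_mem_segment ℝ z y)
  rw [Real.norm_eq_abs] at this
  refine this.trans_eq ?_
  rw [← dist_eq_norm]
  ring

end Calculus

/-! ### Gradient of the sample average throughput -/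

section Gradient

open scoped ContDiff

variable {K N I M : ℕ}

/-- The duality pairing of partial derivatives with directions. -/
def pairing (c v : (Fin K → Fin N → ℝ) × ℝ) : ℝ :=
  ∑ k, ∑ n, c.1 k n * v.1 k n + c.2 * v.2

/-- The partial derivatives of the throughput averaged over the samples in `s`, up to the
factor `β`. -/
def scaledGradient (x : Fin I → Fin K → ℝ) (β : ℝ) (s : Finset (Fin I))
    (z : (Fin K → Fin N → ℝ) × ℝ) : (Fin K → Fin N → ℝ) × ℝ :=
  (fun k n => β * z.2 * ∑ i ∈ s, x i k * g z.1 z.2 (x i) k n,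
    β * ∑ i ∈ s, ∑ k, x i k * ∑ n, z.1 k n * g z.1 z.2 (x i) k n)

theorem hasFDerivAt_throughput (x : Fin K → ℝ) (z : (Fin K → Fin N → ℝ) × ℝ) :
    ∃ L : (Fin K → Fin N → ℝ) × ℝ →L[ℝ] ℝ,
      HasFDerivAt (fun z : (Fin K → Fin N → ℝ) × ℝ => throughput z.1 z.2 x) L z ∧
      ∀ v, L v = ∑ n, ∑ k, g z.1 z.2 x k n * (x k * (z.2 * v.1 k n + z.1 k n * v.2)) := by
  have hcoord : ∀ k n, HasFDerivAt (fun z : (Fin K → Fin N → ℝ) × ℝ => z.1 k n)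
      ((ContinuousLinearMap.proj n).comp ((ContinuousLinearMap.proj k).comp
        (ContinuousLinearMap.fst ℝ (Fin K → Fin N → ℝ) ℝ))) z := fun k n =>
    ContinuousLinearMap.hasFDerivAt ((ContinuousLinearMap.proj (R := ℝ) (φ := fun _ : Fin N => ℝ)
      n).comp ((ContinuousLinearMap.proj (R := ℝ) (φ := fun _ : Fin K => Fin N → ℝ) k).comp
        (ContinuousLinearMap.fst ℝ (Fin K → Fin N → ℝ) ℝ)))
  have hy := fun n k => ((hcoord k n).const_mul (x k)).fun_mul
    (hasFDerivAt_snd (𝕜 := ℝ) (p := z))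
  have h := HasFDerivAt.fun_sum fun n (_ : n ∈ Finset.univ) =>
    hasFDerivAt_sum_mul_prod_one_sub (hy n)
  refine ⟨_, h, fun v => ?_⟩
  simp only [sum_apply, smul_apply,
    add_apply, ContinuousLinearMap.comp_apply, ContinuousLinearMap.proj_apply,
    ContinuousLinearMap.coe_fst', ContinuousLinearMap.coe_snd', smul_eq_mul, g, Finset.mul_sum]
  refine Finset.sum_congr rfl fun n _ => Finset.sum_congr rfl fun k _ => ?_
  congr 1
  · congr 1
    refine Finset.sum_congr rfl fun l _ => ?_
    ring
  · ring

theorem contDiff_sampleThroughput (x : Fin I → Fin K → ℝ) (n : WithTop ℕ∞) :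
    ContDiff ℝ n (sampleThroughput (N := N) x) := by
  unfold sampleThroughput throughput
  fun_prop

theorem analyticAt_sampleThroughput (x : Fin I → Fin K → ℝ) (z : (Fin K → Fin N → ℝ) × ℝ) :
    AnalyticAt ℝ (sampleThroughput x) z :=
  (contDiff_sampleThroughput x ω).contDiffAt.analyticAt

theorem contDiff_scaledGradient (x : Fin I → Fin K → ℝ) (β : ℝ) (s : Finset (Fin I))
    (n : WithTop ℕ∞) : ContDiff ℝ n (scaledGradient (N := N) x β s) := by
  unfold scaledGradient g
  fun_prop

theorem fderiv_sampleThroughput (x : Fin I → Fin K → ℝ) (z v : (Fin K → Fin N → ℝ) × ℝ) :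
    fderiv ℝ (sampleThroughput x) z v
      = pairing (scaledGradient x (1 / (I : ℝ)) Finset.univ z) v := by
  choose L hL hLv using fun i => hasFDerivAt_throughput (x i) z
  have h : HasFDerivAt (sampleThroughput x) _ z :=
    (HasFDerivAt.fun_sum fun i (_ : i ∈ Finset.univ) => hL i).const_mul (1 / (I : ℝ))
  rw [h.fderiv]
  simp only [smul_apply, sum_apply, hLv, smul_eq_mul,
    pairing, scaledGradient, mul_add, Finset.sum_add_distrib, Finset.mul_sum, Finset.sum_mul]
  congr 1
  · rw [Finset.sum_congr rfl fun i _ => Finset.sum_comm, Finset.sum_comm]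
    refine Finset.sum_congr rfl fun k _ => ?_
    rw [Finset.sum_comm]
    refine Finset.sum_congr rfl fun n _ => Finset.sum_congr rfl fun i _ => ?_
    ring
  · refine Finset.sum_congr rfl fun i _ => ?_
    rw [Finset.sum_comm]
    refine Finset.sum_congr rfl fun k _ => Finset.sum_congr rfl fun n _ => ?_
    ring

/-- Unbiasedness of the mini-batch gradient: the batches partition the samples, and the factor `M /
I` compensates the average over `M` batches. -/
theorem average_scaledGradient {batch : Fin M → Finset (Fin I)}
    (hbatch : IsMiniBatchPartition batch) (hM : 0 < M) (x : Fin I → Fin K → ℝ)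
    (z : (Fin K → Fin N → ℝ) × ℝ) :
    (M : ℝ)⁻¹ • ∑ m, scaledGradient x ((M : ℝ) / (I : ℝ)) (batch m) z
      = scaledGradient x (1 / (I : ℝ)) Finset.univ z := by
  have hM' : (M : ℝ) ≠ 0 := Nat.cast_ne_zero.2 hM.ne'
  have hsum : ∀ F : Fin I → ℝ, ∑ m, ∑ i ∈ batch m, F i = ∑ i, F i := by
    intro F
    rw [← Finset.sum_biUnion fun m _ m' _ h => hbatch.disjoint m m' h]
    congr 1
    ext i
    simpa using hbatch.cover i
  refine Prod.ext ?_ ?_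
  · funext k n
    simp only [scaledGradient, Prod.smul_fst, Prod.fst_sum, Pi.smul_apply, Finset.sum_apply,
      smul_eq_mul, ← Finset.mul_sum, hsum]
    field_simp
  · simp only [scaledGradient, Prod.smul_snd, Prod.snd_sum, smul_eq_mul, ← Finset.mul_sum]
    rw [hsum fun i => ∑ k, x i k * ∑ n, z.1 k n * g z.1 z.2 (x i) k n]
    field_simp

end Gradient

/-! ### Countability of the stationary values, face by face -/

section StationaryValues

variable {K N : ℕ}

/-- Directions along which the minimal face of `feasibleSet K N` containing `z` extends. -/
def faceDirection (z : (Fin K → Fin N → ℝ) × ℝ) : Submodule ℝ ((Fin K → Fin N → ℝ) × ℝ) where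
  carrier := {v | (∀ k n, z.1 k n = 0 → v.1 k n = 0) ∧ (∀ k, ∑ n, v.1 k n = 0) ∧
    (z.2 = 0 ∨ z.2 = 1 → v.2 = 0)}
  add_mem' := by
    rintro v w ⟨h1, h2, h3⟩ ⟨h1', h2', h3'⟩
    refine ⟨fun k n h => ?_, fun k => ?_, fun h => ?_⟩
    · simp [h1 k n h, h1' k n h]
    · simp [Finset.sum_add_distrib, h2, h2']
    · simp [h3 h, h3' h]
  zero_mem' := by simp
  smul_mem' := by
    rintro c v ⟨h1, h2, h3⟩
    refine ⟨fun k n h => ?_, fun k => ?_, fun h => ?_⟩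
    · simp [h1 k n h]
    · simp [← Finset.mul_sum, h2]
    · simp [h3 h]

theorem eventually_add_smul_mem_feasibleSet {z v : (Fin K → Fin N → ℝ) × ℝ}
    (hz : z ∈ feasibleSet K N) (hv : v ∈ faceDirection z) :
    ∀ᶠ s in 𝓝 (0 : ℝ), z + s • v ∈ feasibleSet K N := by
  obtain ⟨hz1, hz2, hz3, hz4⟩ := hz
  obtain ⟨hv1, hv2, hv3⟩ := hv
  have hA : ∀ k n, ∀ᶠ s in 𝓝 (0 : ℝ), 0 ≤ z.1 k n + s * v.1 k n := by
    intro k n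
    rcases (hz1 k n).eq_or_lt with h | h
    · exact Eventually.of_forall fun s => by simp [hv1 k n h.symm, ← h]
    · have hc : ContinuousAt (fun s : ℝ => z.1 k n + s * v.1 k n) 0 := by fun_prop
      exact (hc.eventually_const_lt (by simpa using h)).mono fun s hs => hs.le
  have hε : ∀ᶠ s in 𝓝 (0 : ℝ), 0 ≤ z.2 + s * v.2 ∧ z.2 + s * v.2 ≤ 1 := by
    by_cases hb : z.2 = 0 ∨ z.2 = 1
    · exact Eventually.of_forall fun s => by simp [hv3 hb, hz3, hz4]
    · push Not at hb
      have hc : ContinuousAt (fun s : ℝ => z.2 + s * v.2) 0 := by fun_prop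
      have h0 : 0 < z.2 := lt_of_le_of_ne hz3 (Ne.symm hb.1)
      have h1 : z.2 < 1 := lt_of_le_of_ne hz4 hb.2
      filter_upwards [hc.eventually_const_lt (u := 0) (by simpa using h0),
        hc.eventually_lt_const (u := 1) (by simpa using h1)] with s hs1 hs2
      exact ⟨hs1.le, hs2.le⟩
  filter_upwards [eventually_all.2 fun k => eventually_all.2 (hA k), hε] with s hs1 hs2
  refine ⟨fun k n => by simpa using hs1 k n, fun k => ?_, by simpa using hs2.1,
    by simpa using hs2.2⟩
  simp [Finset.sum_add_distrib, ← Finset.mul_sum, hz2, hv2]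

/-- Both `v` and `-v` are feasible directions at `z`, so the stationarity inequality holds with both
signs. -/
theorem fderiv_eq_zero_of_mem_faceDirection {f : (Fin K → Fin N → ℝ) × ℝ → ℝ}
    {z v : (Fin K → Fin N → ℝ) × ℝ} (hz : IsStationaryPointMax f (feasibleSet K N) z)
    (hv : v ∈ faceDirection z) : fderiv ℝ f z v = 0 := by
  have key : ∀ u ∈ faceDirection z, fderiv ℝ f z u ≤ 0 := by
    intro u hu
    obtain ⟨s, hs, hs0⟩ := (((eventually_add_smul_mem_feasibleSet hz.1 hu).filter_mono
      nhdsWithin_le_nhds).and (self_mem_nhdsWithin (s := Set.Ioi (0 : ℝ)))).exists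
    have h := hz.2.2 _ hs
    rw [add_sub_cancel_left, map_smul, smul_eq_mul] at h
    exact nonpos_of_mul_nonpos_right h hs0
  have h1 := key v hv
  have h2 := key (-v) (Submodule.neg_mem _ hv)
  rw [map_neg] at h2
  linarith

theorem countable_image_stationaryPoints {f : (Fin K → Fin N → ℝ) × ℝ → ℝ}
    (hf : ∀ z, AnalyticAt ℝ f z) :
    (f '' {z | IsStationaryPointMax f (feasibleSet K N) z}).Countable := by
  set S := {z | IsStationaryPointMax f (feasibleSet K N) z}
  -- The set of active constraints, which takes finitely many values and determines the face.
  let face : (Fin K → Fin N → ℝ) × ℝ → Set (Fin K × Fin N) × Prop × Prop := fun z =>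
    ({p | z.1 p.1 p.2 = 0}, z.2 = 0, z.2 = 1)
  have hS : S = ⋃ J, S ∩ face ⁻¹' {J} := by
    ext z
    simp
  rw [hS, Set.image_iUnion]
  refine Set.countable_iUnion fun J => ?_
  rcases (S ∩ face ⁻¹' {J}).eq_empty_or_nonempty with h | ⟨z₀, hz₀, hJ₀⟩
  · simp [h]
  -- All stationary points with the same active constraints lie in one affine space through `z₀` and
  -- are critical for the restriction of `f` to it.
  · refine (countable_criticalValues fun v : faceDirection z₀ => f (z₀ + v)).mono ?_
    rintro _ ⟨z, ⟨hz, hJ⟩, rfl⟩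
    have hface : face z = face z₀ := by
      rw [Set.mem_preimage, Set.mem_singleton_iff] at hJ hJ₀
      rw [hJ, hJ₀]
    have hA : ∀ k n, z.1 k n = 0 ↔ z₀.1 k n = 0 := fun k n =>
      Set.ext_iff.1 (congrArg Prod.fst hface) (k, n)
    have h0 : z.2 = 0 ↔ z₀.2 = 0 := (congrArg (fun J => J.2.1) hface).to_iff
    have h1 : z.2 = 1 ↔ z₀.2 = 1 := (congrArg (fun J => J.2.2) hface).to_iff
    have hmem : z - z₀ ∈ faceDirection z₀ := by
      refine ⟨fun k n h => ?_, fun k => ?_, fun h => ?_⟩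
      · simp [h, (hA k n).2 h]
      · simp [hz.1.2.1 k, hz₀.1.2.1 k]
      · rcases h with h | h
        · simp [h, h0.2 h]
        · simp [h, h1.2 h]
    have hadd : z₀ + (z - z₀) = z := by abel
    have haff : HasFDerivAt (fun v : faceDirection z₀ => z₀ + (v : (Fin K → Fin N → ℝ) × ℝ))
        (faceDirection z₀).subtypeL ⟨z - z₀, hmem⟩ :=
      (faceDirection z₀).subtypeL.hasFDerivAt.const_add z₀
    refine ⟨⟨z - z₀, hmem⟩, ⟨?_, ?_⟩, by simp⟩
    · refine AnalyticAt.fun_comp (hf _) ?_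
      exact analyticAt_const.add ((faceDirection z₀).subtypeL.analyticAt _)
    · have hd : HasFDerivAt f (fderiv ℝ f z) (z₀ + (z - z₀)) := by
        rw [hadd]
        exact (hf z).differentiableAt.hasFDerivAt
      have hcomp := HasFDerivAt.comp (⟨z - z₀, hmem⟩ : faceDirection z₀) hd haff
      refine hcomp.fderiv.trans ?_
      ext u
      refine fderiv_eq_zero_of_mem_faceDirection hz ?_
      obtain ⟨u, hu1, hu2, hu3⟩ := u
      exact ⟨fun k n h => hu1 k n ((hA k n).1 h), hu2,
        fun h => hu3 (h.imp h0.1 h1.1)⟩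

end StationaryValues

/-! ### Convexity, closedness and boundedness of the feasible set -/

section Feasible

variable {K N : ℕ}

theorem convex_feasibleSet : Convex ℝ (feasibleSet K N) := by
  rintro z ⟨h1, h2, h3, h4⟩ w ⟨h1', h2', h3', h4'⟩ a b ha hb hab
  refine ⟨fun k n => ?_, fun k => ?_, ?_, ?_⟩
  · simpa using add_nonneg (mul_nonneg ha (h1 k n)) (mul_nonneg hb (h1' k n))
  · simp [Finset.sum_add_distrib, ← Finset.mul_sum, h2, h2', hab]
  · simpa using add_nonneg (mul_nonneg ha h3) (mul_nonneg hb h3')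
  · simp only [Prod.snd_add, Prod.smul_snd, smul_eq_mul]
    nlinarith

theorem isClosed_feasibleSet : IsClosed (feasibleSet K N) := by
  have : feasibleSet K N = (⋂ k, ⋂ n, {z | 0 ≤ z.1 k n}) ∩ ((⋂ k, {z | ∑ n, z.1 k n = 1}) ∩
      ({z | 0 ≤ z.2} ∩ {z | z.2 ≤ 1})) := by
    ext z
    simp [feasibleSet]
  rw [this]
  refine IsClosed.inter (isClosed_iInter fun k => isClosed_iInter fun n => ?_)
    (IsClosed.inter (isClosed_iInter fun k => ?_) (IsClosed.inter ?_ ?_))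
  · exact isClosed_le (by fun_prop) (by fun_prop)
  · exact isClosed_eq (by fun_prop) (by fun_prop)
  · exact isClosed_le (by fun_prop) (by fun_prop)
  · exact isClosed_le (by fun_prop) (by fun_prop)

theorem norm_le_one_of_mem_feasibleSet {z : (Fin K → Fin N → ℝ) × ℝ} (hz : z ∈ feasibleSet K N) :
    ‖z‖ ≤ 1 := by
  obtain ⟨h1, h2, h3, h4⟩ := hz
  rw [Prod.norm_def, max_le_iff, pi_norm_le_iff_of_nonneg zero_le_one]
  refine ⟨fun k => (pi_norm_le_iff_of_nonneg zero_le_one).2 fun n => ?_, ?_⟩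
  · rw [Real.norm_of_nonneg (h1 k n), ← h2 k]
    exact Finset.single_le_sum (fun n _ => h1 k n) (Finset.mem_univ n)
  · rwa [Real.norm_of_nonneg h3]

end Feasible

/-! ### Boundedness of the iterates and feasibility of their cluster points -/

section Averaging

variable {E : Type*} [NormedAddCommGroup E] [NormedSpace ℝ E] {ω : ℕ → ℝ}

/-- Early steps `ω` may exceed `1`, so iterates can leave the feasible set. Only finitely many steps
do so, whence a bound depending on `ω` alone and uniform over all runs. -/
theorem exists_norm_le_of_convexCombination (hω : IsDiminishingStepSize ω) :
    ∃ R, 1 ≤ R ∧ ∀ z d : ℕ → E, ‖z 0‖ ≤ 1 → (∀ t, ‖d t‖ ≤ 1) →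
      (∀ t, z (t + 1) = (1 - ω (t + 1)) • z t + ω (t + 1) • d t) → ∀ t, ‖z t‖ ≤ R := by
  have hstep : ∀ z d : ℕ → E, (∀ t, ‖d t‖ ≤ 1) →
      (∀ t, z (t + 1) = (1 - ω (t + 1)) • z t + ω (t + 1) • d t) →
      ∀ t, ‖z (t + 1)‖ ≤ |1 - ω (t + 1)| * ‖z t‖ + ω (t + 1) := by
    intro z d hd hz t
    have hpos := hω.pos (t + 1) (by omega)
    rw [hz]
    refine (norm_add_le _ _).trans ?_
    rw [norm_smul, norm_smul, Real.norm_eq_abs, Real.norm_of_nonneg hpos.le]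
    have := mul_le_mul_of_nonneg_left (hd t) hpos.le
    linarith
  obtain ⟨T, hT⟩ := eventually_atTop.1 hω.eventually_mem_Icc
  have hinit : ∀ T, ∃ R, 1 ≤ R ∧ ∀ z d : ℕ → E, ‖z 0‖ ≤ 1 → (∀ t, ‖d t‖ ≤ 1) →
      (∀ t, z (t + 1) = (1 - ω (t + 1)) • z t + ω (t + 1) • d t) → ∀ t ≤ T, ‖z t‖ ≤ R := by
    intro T
    induction T with
    | zero => exact ⟨1, le_rfl, fun z d h0 _ _ t ht => by rwa [Nat.le_zero.1 ht]⟩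
    | succ T ih =>
      obtain ⟨R, hR, h⟩ := ih
      refine ⟨max R (|1 - ω (T + 1)| * R + ω (T + 1)), hR.trans (le_max_left _ _),
        fun z d h0 hd hz t ht => ?_⟩
      rcases Nat.le_succ_iff.1 ht with ht | rfl
      · exact (h z d h0 hd hz t ht).trans (le_max_left _ _)
      · refine le_trans ?_ (le_max_right _ _)
        refine (hstep z d hd hz T).trans ?_
        gcongr
        exact h z d h0 hd hz T le_rfl
  obtain ⟨R, hR, h⟩ := hinit T
  refine ⟨R, hR, fun z d h0 hd hz t => ?_⟩
  rcases le_total t T with ht | ht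
  · exact h z d h0 hd hz t ht
  · induction t, ht using Nat.le_induction with
    | base => exact h z d h0 hd hz T le_rfl
    | succ t ht ih =>
      obtain ⟨h1, h2⟩ := hT t ht
      refine (hstep z d hd hz t).trans ?_
      rw [abs_of_nonneg (by linarith)]
      nlinarith

/-- Once `ω ≤ 1`, each step shrinks the distance to `F` by the factor `1 - ω`, so early
infeasibility is forgotten. -/
theorem mem_of_mapClusterPt_convexCombination [ProperSpace E] (hω : IsDiminishingStepSize ω)
    {F : Set E} (hF : Convex ℝ F) (hFc : IsClosed F) {z d : ℕ → E} (hd : ∀ t, d t ∈ F)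
    (hz : ∀ t, z (t + 1) = (1 - ω (t + 1)) • z t + ω (t + 1) • d t)
    {y : E} (hy : MapClusterPt y atTop z) : y ∈ F := by
  have hne : F.Nonempty := ⟨d 0, hd 0⟩
  have hlim : Tendsto (fun t => Metric.infDist (z t) F) atTop (𝓝 0) := by
    refine tendsto_zero_of_le_convexCombination (β := fun _ => 0)
      (fun _ => Metric.infDist_nonneg) hω.eventually_mem_Icc hω.tendsto_sum_range
      tendsto_const_nhds ?_
    filter_upwards [hω.eventually_mem_Icc] with t ht
    obtain ⟨q, hq, hdist⟩ := hFc.exists_infDist_eq_dist hne (z t)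
    have hmem : (1 - ω (t + 1)) • q + ω (t + 1) • d t ∈ F :=
      hF hq (hd t) (by linarith [ht.2]) ht.1 (by ring)
    refine (Metric.infDist_le_dist_of_mem hmem).trans_eq ?_
    have hnn : 0 ≤ 1 - ω (t + 1) := sub_nonneg.2 ht.2
    rw [hz, dist_add_right, dist_eq_norm, ← smul_sub, norm_smul, Real.norm_of_nonneg hnn,
      ← dist_eq_norm, ← hdist, mul_zero, add_zero]
  have hφ : ContinuousAt (fun x => Metric.infDist x F) y :=
    (Metric.continuous_infDist_pt F).continuousAt
  have h2 := hy.continuousAt_comp hφ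
  have h3 : NeBot (𝓝 (Metric.infDist y F) ⊓ 𝓝 0) := NeBot.mono h2 (inf_le_inf_left _ hlim)
  exact (hFc.mem_iff_infDist_zero hne).2 (eq_of_nhds_neBot h3)

end Averaging

/-! ### First-order gain of the surrogate step -/

section Target

variable {K N : ℕ}

/-- The unit vector of a chosen maximiser of `c`. -/
def argmaxVertex (c : Fin N → ℝ) : Fin N → ℝ :=
  open Classical in if h : ∃ m, m ∈ argmaxSet c then Pi.single h.choose 1 else 0

theorem exists_argmaxVertex_eq [Nonempty (Fin N)] (c : Fin N → ℝ) :
    ∃ m ∈ argmaxSet c, argmaxVertex c = Pi.single m 1 := by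
  have h : ∃ m, m ∈ argmaxSet c := Finite.exists_max c
  exact ⟨h.choose, h.choose_spec, by rw [argmaxVertex, dif_pos h]⟩

theorem argmaxVertex_eq_single {c : Fin N → ℝ} {n m : Fin N} (hn : argmaxSet c = {n})
    (hm : m ∈ argmaxSet c) : argmaxVertex c = Pi.single m 1 := by
  have : Nonempty (Fin N) := ⟨n⟩
  obtain ⟨m', hm', h⟩ := exists_argmaxVertex_eq c
  rw [hn, Set.mem_singleton_iff] at hm hm'
  rw [h, hm, hm']

theorem sum_mul_le_sum_mul_argmaxVertex [Nonempty (Fin N)] (c : Fin N → ℝ) {w : Fin N → ℝ}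
    (hw : ∀ n, 0 ≤ w n) (hw1 : ∑ n, w n = 1) :
    ∑ n, c n * w n ≤ ∑ n, c n * argmaxVertex c n := by
  obtain ⟨m, hm, h⟩ := exists_argmaxVertex_eq c
  have h1 : ∑ n, c n * argmaxVertex c n = c m := by
    rw [h, Finset.sum_eq_single m] <;> simp +contextual
  calc ∑ n, c n * w n ≤ ∑ n, c m * w n :=
        Finset.sum_le_sum fun n _ => mul_le_mul_of_nonneg_right (hm n) (hw n)
    _ = ∑ n, c n * argmaxVertex c n := by rw [← Finset.mul_sum, hw1, mul_one, h1]

/-- The proximal gradient step on the unit interval. -/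
def proxStep (τ s c : ℝ) : ℝ := min (max (s + c / (2 * τ)) 0) 1

theorem proxStep_mem (τ s c : ℝ) : 0 ≤ proxStep τ s c ∧ proxStep τ s c ≤ 1 :=
  ⟨le_min (le_max_right _ _) zero_le_one, min_le_right _ _⟩

theorem mul_proxStep_sub_nonneg {τ s c : ℝ} (hτ : 0 < τ) (hs0 : 0 ≤ s) (hs1 : s ≤ 1) :
    0 ≤ c * (proxStep τ s c - s) := by
  rcases le_total 0 c with hc | hc
  · refine mul_nonneg hc (sub_nonneg.2 (le_min (le_max_of_le_left ?_) hs1))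
    have : 0 ≤ c / (2 * τ) := by positivity
    linarith
  · refine mul_nonneg_of_nonpos_of_nonpos hc (sub_nonpos.2 (min_le_of_left_le (max_le ?_ hs0)))
    have : c / (2 * τ) ≤ 0 := div_nonpos_of_nonpos_of_nonneg hc (by positivity)
    linarith

/-- The step stalls only if `c = 0` or `s` is the endpoint towards which `c` points; an improving
`r` in the interval rules out both. -/
theorem mul_proxStep_sub_pos {τ s c r : ℝ} (hτ : 0 < τ) (hs0 : 0 ≤ s) (hs1 : s ≤ 1)
    (hr0 : 0 ≤ r) (hr1 : r ≤ 1) (h : 0 < c * (r - s)) : 0 < c * (proxStep τ s c - s) := by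
  refine lt_of_le_of_ne (mul_proxStep_sub_nonneg hτ hs0 hs1) fun h0 => ?_
  have hc : c ≠ 0 := by
    rintro rfl
    simp at h
  have heq : proxStep τ s c = s := by
    rcases mul_eq_zero.1 h0.symm with h1 | h1
    · exact absurd h1 hc
    · linarith
  rcases hc.lt_or_gt with hc | hc
  · have hlt : c / (2 * τ) < 0 := div_neg_of_neg_of_pos hc (by positivity)
    have hs : 0 < s := by nlinarith
    have : proxStep τ s c < s := min_lt_of_left_lt (max_lt (by linarith) hs)
    exact this.ne heq
  · have hlt : 0 < c / (2 * τ) := by positivity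
    have hs : s < 1 := by nlinarith
    have : s < proxStep τ s c := lt_min (lt_max_of_lt_left (by linarith)) hs
    exact this.ne' heq

/-- The maximiser of the convex surrogate with averaged partial derivatives `c`. -/
def surrogateMaximizer (τ : ℝ) (z c : (Fin K → Fin N → ℝ) × ℝ) : (Fin K → Fin N → ℝ) × ℝ :=
  (fun k => argmaxVertex (c.1 k), proxStep τ z.2 c.2)

theorem surrogateMaximizer_mem_feasibleSet (a : Fin K → Fin N) (τ : ℝ)
    (z c : (Fin K → Fin N → ℝ) × ℝ) : surrogateMaximizer τ z c ∈ feasibleSet K N := by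
  have hv : ∀ k, ∃ m, argmaxVertex (c.1 k) = Pi.single m 1 := fun k => by
    have : Nonempty (Fin N) := ⟨a k⟩
    obtain ⟨m, -, h⟩ := exists_argmaxVertex_eq (c.1 k)
    exact ⟨m, h⟩
  refine ⟨fun k n => ?_, fun k => ?_, (proxStep_mem _ _ _).1, (proxStep_mem _ _ _).2⟩
  · obtain ⟨m, hm⟩ := hv k
    simp only [surrogateMaximizer, hm, Pi.single_apply]
    split_ifs <;> norm_num
  · obtain ⟨m, hm⟩ := hv k
    simp [surrogateMaximizer, hm]

/-- A lower bound for the first-order gain of the surrogate step, continuous in `z` and `c`. -/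
def gain (τ : ℝ) (w z c : (Fin K → Fin N → ℝ) × ℝ) : ℝ :=
  ∑ k, ∑ n, c.1 k n * (w.1 k n - z.1 k n) + c.2 * (proxStep τ z.2 c.2 - z.2)

theorem continuous_gain (τ : ℝ) (w : (Fin K → Fin N → ℝ) × ℝ) :
    Continuous fun q : ((Fin K → Fin N → ℝ) × ℝ) × ((Fin K → Fin N → ℝ) × ℝ) =>
      gain τ w q.1 q.2 := by
  unfold gain proxStep
  fun_prop

theorem exists_nhds_lt_of_continuous {X : Type*} [TopologicalSpace X] [AddMonoid X]
    [ContinuousAdd X] {Q : X → X → ℝ} (hQ : Continuous fun q : X × X => Q q.1 q.2) {G : X → X}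
    (hG : Continuous G) {r : ℝ} {y : X} (h : r < Q y (G y)) :
    ∃ U ∈ 𝓝 y, ∃ V ∈ 𝓝 (0 : X), ∀ z ∈ U, ∀ e ∈ V, r < Q z (G z + e) := by
  have hcont : Continuous fun q : X × X => Q q.1 (G q.1 + q.2) :=
    hQ.comp (continuous_fst.prodMk ((hG.comp continuous_fst).add continuous_snd))
  have hlim := hcont.tendsto (y, 0)
  simp only [add_zero] at hlim
  have hev := hlim.eventually_const_lt h
  rw [nhds_prod_eq] at hev
  obtain ⟨U, hU, V, hV, hUV⟩ := mem_prod_iff.1 hev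
  exact ⟨U, hU, V, hV, fun z hz e he => hUV (Set.mk_mem_prod hz he)⟩

/-- The maximising vertex jumps with `c`, so the actual first-order gain is discontinuous; comparing
with a fixed competitor `w` gives a continuous lower bound that persists near a cluster point. -/
theorem gain_le_pairing (a : Fin K → Fin N) (τ : ℝ) {w : (Fin K → Fin N → ℝ) × ℝ}
    (hw : w ∈ feasibleSet K N) (z c : (Fin K → Fin N → ℝ) × ℝ) :
    gain τ w z c ≤ pairing c (surrogateMaximizer τ z c - z) := by
  refine add_le_add (Finset.sum_le_sum fun k _ => ?_) le_rfl
  have : Nonempty (Fin N) := ⟨a k⟩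
  have h := sum_mul_le_sum_mul_argmaxVertex (c.1 k) (hw.1 k) (hw.2.1 k)
  simp only [mul_sub, Finset.sum_sub_distrib, surrogateMaximizer, Prod.fst_sub, Pi.sub_apply]
  linarith

/-- If the preamble part of the pairing is positive, `w` itself serves. Otherwise the barring part
is positive, and the competitor `y` makes the preamble part zero. -/
theorem exists_gain_pos {τ : ℝ} (hτ : 0 < τ) {y w c : (Fin K → Fin N → ℝ) × ℝ}
    (hy : y ∈ feasibleSet K N) (hw : w ∈ feasibleSet K N) (h : 0 < pairing c (w - y)) :
    ∃ w' ∈ feasibleSet K N, 0 < gain τ w' y c := by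
  by_cases hA : 0 < ∑ k, ∑ n, c.1 k n * (w.1 k n - y.1 k n)
  · exact ⟨w, hw, add_pos_of_pos_of_nonneg hA
      (mul_proxStep_sub_nonneg hτ hy.2.2.1 hy.2.2.2)⟩
  · refine ⟨y, hy, ?_⟩
    have h2 : 0 < c.2 * (w.2 - y.2) := by
      have h' : 0 < ∑ k, ∑ n, c.1 k n * (w.1 k n - y.1 k n) + c.2 * (w.2 - y.2) := h
      linarith
    have := mul_proxStep_sub_pos hτ hy.2.2.1 hy.2.2.2 hw.2.2.1 hw.2.2.2 h2
    simpa [gain] using this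

theorem abs_pairing_le (c v : (Fin K → Fin N → ℝ) × ℝ) :
    |pairing c v| ≤ (K * N + 1) * (‖c‖ * ‖v‖) := by
  have h1 : ∀ k n, |c.1 k n * v.1 k n| ≤ ‖c‖ * ‖v‖ := by
    intro k n
    rw [abs_mul]
    exact mul_le_mul
      ((norm_le_pi_norm (c.1 k) n).trans ((norm_le_pi_norm c.1 k).trans (norm_fst_le c)))
      ((norm_le_pi_norm (v.1 k) n).trans ((norm_le_pi_norm v.1 k).trans (norm_fst_le v)))
      (abs_nonneg _) (norm_nonneg _)
  have h2 : |c.2 * v.2| ≤ ‖c‖ * ‖v‖ := by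
    rw [abs_mul]
    exact mul_le_mul (norm_snd_le c) (norm_snd_le v) (abs_nonneg _) (norm_nonneg _)
  have h3 : |∑ k, ∑ n, c.1 k n * v.1 k n| ≤ K * N * (‖c‖ * ‖v‖) := by
    calc |∑ k, ∑ n, c.1 k n * v.1 k n| ≤ ∑ k : Fin K, ∑ n : Fin N, ‖c‖ * ‖v‖ :=
          (Finset.abs_sum_le_sum_abs _ _).trans (Finset.sum_le_sum fun k _ =>
            (Finset.abs_sum_le_sum_abs _ _).trans (Finset.sum_le_sum fun n _ => h1 k n))
      _ = K * N * (‖c‖ * ‖v‖) := by simp [mul_assoc]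
  calc |pairing c v| ≤ K * N * (‖c‖ * ‖v‖) + ‖c‖ * ‖v‖ :=
        (abs_add_le _ _).trans (add_le_add h3 h2)
    _ = _ := by ring

theorem pairing_add_left (c e v : (Fin K → Fin N → ℝ) × ℝ) :
    pairing (c + e) v = pairing c v + pairing e v := by
  simp only [pairing, Prod.fst_add, Prod.snd_add, Pi.add_apply, add_mul, Finset.sum_add_distrib]
  ring

end Target

/-! ### Stationarity of limit points and gradient tracking along runs -/

section Convergence

variable {K N I M : ℕ}

/-- If the averaged partial derivatives track the gradient, then every limit point of the
iterates is stationary. -/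
theorem isStationaryPointMax_of_tendsto_gradient (a : Fin K → Fin N) (x : Fin I → Fin K → ℝ)
    {ω : ℕ → ℝ} (hω : IsDiminishingStepSize ω) {τ : ℝ} (hτ : 0 < τ)
    {z c : ℕ → (Fin K → Fin N → ℝ) × ℝ} {R : ℝ} (hzR : ∀ t, ‖z t‖ ≤ R)
    (hz : ∀ t, z (t + 1) = (1 - ω (t + 1)) • z t
      + ω (t + 1) • surrogateMaximizer τ (z t) (c (t + 1)))
    (hc : Tendsto (fun t => c t - scaledGradient x (1 / (I : ℝ)) Finset.univ (z t))
      atTop (𝓝 0))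
    {y : (Fin K → Fin N → ℝ) × ℝ} (hy : MapClusterPt y atTop z) :
    IsStationaryPointMax (sampleThroughput x) (feasibleSet K N) y := by
  set f : (Fin K → Fin N → ℝ) × ℝ → ℝ := sampleThroughput x with hf
  set G : (Fin K → Fin N → ℝ) × ℝ → (Fin K → Fin N → ℝ) × ℝ :=
    scaledGradient x (1 / (I : ℝ)) Finset.univ with hG
  set d : ℕ → (Fin K → Fin N → ℝ) × ℝ := fun t => surrogateMaximizer τ (z t) (c (t + 1)) with hd
  have hdF : ∀ t, d t ∈ feasibleSet K N := fun t => surrogateMaximizer_mem_feasibleSet a _ _ _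
  have hωpos : ∀ t, 0 < ω (t + 1) := fun t => hω.pos _ (by omega)
  have hω0 : Tendsto (fun t => ω (t + 1)) atTop (𝓝 0) :=
    hω.tendsto_zero.comp (tendsto_add_atTop_nat 1)
  have hGc : Continuous G := (contDiff_scaledGradient x _ _ 1).continuous
  have hdz : ∀ t, ‖d t - z t‖ ≤ 1 + R := fun t =>
    (norm_sub_le _ _).trans (add_le_add (norm_le_one_of_mem_feasibleSet (hdF t)) (hzR t))
  have hdiff : ∀ t, z (t + 1) - z t = ω (t + 1) • (d t - z t) := by
    intro t
    rw [hz]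
    module
  have hdist : ∀ t, dist (z (t + 1)) (z t) ≤ (1 + R) * ω (t + 1) := by
    intro t
    rw [dist_eq_norm, hdiff, norm_smul, Real.norm_of_nonneg (hωpos t).le, mul_comm]
    exact mul_le_mul_of_nonneg_right (hdz t) (hωpos t).le
  have hball : ∀ t, z t ∈ Metric.closedBall (0 : (Fin K → Fin N → ℝ) × ℝ) R := fun t => by
    simpa using hzR t
  -- The step from `z t` uses `c (t + 1)`, which tracks `G (z (t + 1))`; the offset is bridged by
  -- Lipschitz continuity and vanishing steps.
  set e : ℕ → (Fin K → Fin N → ℝ) × ℝ := fun t => c (t + 1) - G (z t) with he_def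
  have he : Tendsto e atTop (𝓝 0) := by
    obtain ⟨L, hL0, hL⟩ := exists_lipschitz_bound_of_contDiff (contDiff_scaledGradient (N := N) x
      (1 / (I : ℝ)) Finset.univ 1) R
    have h1 : Tendsto (fun t => G (z (t + 1)) - G (z t)) atTop (𝓝 0) := by
      refine squeeze_zero_norm (a := fun t => L * ((1 + R) * ω (t + 1))) (fun t => ?_) ?_
      · exact (hL _ (hball _) _ (hball _)).trans (mul_le_mul_of_nonneg_left (hdist t) hL0)
      · simpa using (hω0.const_mul (1 + R)).const_mul L
    have h2 := (hc.comp (tendsto_add_atTop_nat 1)).add h1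
    rw [add_zero] at h2
    refine h2.congr fun t => ?_
    simp [he_def]
  obtain ⟨C, hC0, hC⟩ := exists_taylor_bound_of_contDiff (contDiff_sampleThroughput (N := N) x 2) R
  have herr : Tendsto (fun t => pairing (e t) (d t - z t)) atTop (𝓝 0) := by
    refine squeeze_zero_norm (a := fun t => (K * N + 1) * (‖e t‖ * (1 + R))) (fun t => ?_) ?_
    · refine (abs_pairing_le _ _).trans ?_
      gcongr
      exact hdz t
    · simpa using ((tendsto_zero_iff_norm_tendsto_zero.1 he).mul_const (1 + R)).const_mul
        ((K : ℝ) * N + 1)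
  have hquad : Tendsto (fun t => C * (1 + R) ^ 2 * ω (t + 1)) atTop (𝓝 0) := by
    simpa using hω0.const_mul (C * (1 + R) ^ 2)
  have hanal : ∀ z, AnalyticAt ℝ f z := analyticAt_sampleThroughput x
  refine mem_of_mapClusterPt_of_ascent (S := {z | IsStationaryPointMax f (feasibleSet K N) z})
    (isCompact_closedBall (0 : (Fin K → Fin N → ℝ) × ℝ) R) hball
    (contDiff_sampleThroughput x 1).continuous (countable_image_stationaryPoints hanal)
    hωpos hω0 hω.tendsto_sum_range hdist ?_ hy
  intro y hy hyS
  have hyF : y ∈ feasibleSet K N :=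
    mem_of_mapClusterPt_convexCombination hω convex_feasibleSet isClosed_feasibleSet hdF hz hy
  obtain ⟨w, hw, hwpos⟩ : ∃ w ∈ feasibleSet K N, 0 < pairing (G y) (w - y) := by
    by_contra! hcon
    refine hyS ⟨hyF, (hanal y).differentiableAt, fun w hw => ?_⟩
    rw [hf, fderiv_sampleThroughput]
    exact hcon w hw
  obtain ⟨w, hw, hgain⟩ := exists_gain_pos hτ hyF hw hwpos
  -- Of the gain `4 * η` at `y`, one `η` is lost in passing to a neighbourhood, one to the tracking
  -- error and one to the Taylor remainder; one remains.
  set η := gain τ w y (G y) / 4 with hη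
  have hη0 : 0 < η := by positivity
  obtain ⟨U, hU, V, hV, hUV⟩ := exists_nhds_lt_of_continuous (continuous_gain τ w) hGc
    (show 3 * η < gain τ w y (G y) by linarith)
  refine ⟨η, hη0, U, hU, ?_⟩
  filter_upwards [he hV, herr.eventually_lt_const hη0, hquad.eventually_lt_const hη0]
    with t h1 h2 h3 hzU
  have h4 : 3 * η < gain τ w (z t) (G (z t) + e t) := hUV _ hzU _ h1
  have hce : G (z t) + e t = c (t + 1) := by simp [he_def]
  have h5 : gain τ w (z t) (c (t + 1)) ≤ pairing (c (t + 1)) (d t - z t) :=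
    gain_le_pairing a τ hw (z t) (c (t + 1))
  have h6 : pairing (c (t + 1)) (d t - z t)
      = pairing (G (z t)) (d t - z t) + pairing (e t) (d t - z t) := by
    rw [← pairing_add_left, hce]
  rw [hce] at h4
  have h7 := (abs_le.1 (hC _ (hball (t + 1)) _ (hball t))).1
  have h8 : fderiv ℝ f (z t) (z (t + 1) - z t)
      = ω (t + 1) * pairing (G (z t)) (d t - z t) := by
    rw [hdiff, map_smul, smul_eq_mul, hf, fderiv_sampleThroughput]
  rw [← hf, h8] at h7
  have h9 : C * dist (z (t + 1)) (z t) ^ 2 ≤ ω (t + 1) * η := by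
    calc C * dist (z (t + 1)) (z t) ^ 2 ≤ C * ((1 + R) * ω (t + 1)) ^ 2 := by
          gcongr
          exact hdist t
      _ = ω (t + 1) * (C * (1 + R) ^ 2 * ω (t + 1)) := by ring
      _ ≤ ω (t + 1) * η := mul_le_mul_of_nonneg_left h3.le (hωpos t).le
  have h10 : ω (t + 1) * (2 * η) ≤ ω (t + 1) * pairing (G (z t)) (d t - z t) :=
    mul_le_mul_of_nonneg_left (by linarith) (hωpos t).le
  linarith

/-- The run of the algorithm with initial preambles `a` and mini-batch indices `p` under a fixed
selection of the maximisers: the iterate and the averaged partial derivatives. -/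
def selectedRun (x : Fin I → Fin K → ℝ) (batch : Fin M → Finset (Fin I)) (ρ ω : ℕ → ℝ) (τ : ℝ)
    (a : Fin K → Fin N) :
    ℕ → (ℕ → Fin M) → ((Fin K → Fin N → ℝ) × ℝ) × ((Fin K → Fin N → ℝ) × ℝ)
  | 0 => fun _ => ((fun k => Pi.single (a k) 1, 1), 0)
  | t + 1 => fun p =>
      let s := selectedRun x batch ρ ω τ a t p
      let c := (1 - ρ (t + 1)) • s.2
        + ρ (t + 1) • scaledGradient x ((M : ℝ) / (I : ℝ)) (batch (p (t + 1))) s.1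
      ((1 - ω (t + 1)) • s.1 + ω (t + 1) • surrogateMaximizer τ s.1 c, c)

variable {x : Fin I → Fin K → ℝ} {batch : Fin M → Finset (Fin I)} {ρ ω : ℕ → ℝ} {τ : ℝ}

theorem selectedRun_succ_snd (a : Fin K → Fin N) (t : ℕ) (p : ℕ → Fin M) :
    (selectedRun x batch ρ ω τ a (t + 1) p).2
      = (1 - ρ (t + 1)) • (selectedRun x batch ρ ω τ a t p).2
        + ρ (t + 1) • scaledGradient x ((M : ℝ) / (I : ℝ)) (batch (p (t + 1)))
          (selectedRun x batch ρ ω τ a t p).1 := rfl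

theorem selectedRun_succ_fst (a : Fin K → Fin N) (t : ℕ) (p : ℕ → Fin M) :
    (selectedRun x batch ρ ω τ a (t + 1) p).1
      = (1 - ω (t + 1)) • (selectedRun x batch ρ ω τ a t p).1
        + ω (t + 1) • surrogateMaximizer τ (selectedRun x batch ρ ω τ a t p).1
          (selectedRun x batch ρ ω τ a (t + 1) p).2 := rfl

theorem selectedRun_congr (a : Fin K → Fin N) (t : ℕ) {p q : ℕ → Fin M}
    (h : ∀ s ≤ t, p s = q s) :
    selectedRun x batch ρ ω τ a t p = selectedRun x batch ρ ω τ a t q := by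
  induction t with
  | zero => rfl
  | succ t ih =>
    simp only [selectedRun, ih fun s hs => h s (hs.trans (Nat.le_succ t)), h (t + 1) le_rfl]

theorem norm_selectedRun_zero_le (a : Fin K → Fin N) (p : ℕ → Fin M) :
    ‖(selectedRun x batch ρ ω τ a 0 p).1‖ ≤ 1 := by
  refine norm_le_one_of_mem_feasibleSet ⟨fun k n => ?_, fun k => ?_, zero_le_one, le_rfl⟩
  · simp only [selectedRun, Pi.single_apply]
    split_ifs <;> norm_num
  · simp [selectedRun]

/-- With a unique maximiser there is nothing to choose, so an arbitrary, possibly non-adapted,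
selection agrees with the fixed one. -/
theorem IsSCARun.eq_selectedRun {n₀ : Fin K → Fin N} {ξ : ℕ → Fin M}
    {A : ℕ → Fin K → Fin N → ℝ} {ε : ℕ → ℝ} (h : IsSCARun x batch ρ ω τ n₀ ξ A ε)
    (huniq : ∀ t, 1 ≤ t → ∀ k, ∃ n, argmaxSet (cA x batch ρ ξ A ε t k) = {n}) (t : ℕ) :
    selectedRun x batch ρ ω τ n₀ t ξ
      = ((A t, ε t), (cA x batch ρ ξ A ε t, cEps x batch ρ ξ A ε t)) := by
  induction t with
  | zero =>
    have hA : A 0 = fun k => Pi.single (n₀ k) 1 := funext h.init_A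
    rw [hA, h.init_eps]
    rfl
  | succ t ih =>
    have hc : (selectedRun x batch ρ ω τ n₀ (t + 1) ξ).2
        = (cA x batch ρ ξ A ε (t + 1), cEps x batch ρ ξ A ε (t + 1)) := by
      rw [selectedRun_succ_snd, ih]
      rfl
    refine Prod.ext ?_ hc
    rw [selectedRun_succ_fst, hc, ih]
    refine Prod.ext (funext fun k => ?_) (h.step_eps t).symm
    obtain ⟨m, hm, hA⟩ := h.step_A t k
    obtain ⟨n, hn⟩ := huniq (t + 1) (by omega) k
    refine Eq.trans ?_ hA.symm
    rw [← argmaxVertex_eq_single hn hm]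
    rfl

theorem ae_tendsto_selectedRun_sub_gradient {Ω : Type*} [MeasurableSpace Ω] {P : Measure Ω}
    [IsProbabilityMeasure P] {ξ : ℕ → Ω → Fin M} (hξ : ∀ t, Measurable (ξ t))
    (hunif : ∀ t m, P (ξ t ⁻¹' {m}) = (M : ℝ≥0∞)⁻¹) (hind : iIndepFun ξ P)
    (hbatch : IsMiniBatchPartition batch) (hM : 0 < M)
    (hρ : IsDiminishingStepSize ρ) (hω : IsDiminishingStepSize ω)
    (hωρ : Tendsto (fun t => ω t / ρ t) atTop (𝓝 0)) (a : Fin K → Fin N)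
    {R : ℝ} (hR : ∀ t p, ‖(selectedRun x batch ρ ω τ a t p).1‖ ≤ R) :
    ∀ᵐ w ∂P, Tendsto (fun t => (selectedRun x batch ρ ω τ a t fun s => ξ s w).2
      - scaledGradient x (1 / (I : ℝ)) Finset.univ
          (selectedRun x batch ρ ω τ a t fun s => ξ s w).1) atTop (𝓝 0) := by
  set B := Metric.closedBall (0 : (Fin K → Fin N → ℝ) × ℝ) R
  have hB : ∀ t p, (selectedRun x batch ρ ω τ a t p).1 ∈ B := fun t p => by
    simpa [B] using hR t p
  obtain ⟨C, hC⟩ := (isCompact_closedBall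
    (0 : (Fin K → Fin N → ℝ) × ℝ) R).exists_bound_of_continuousOn
    (f := fun z m => scaledGradient x ((M : ℝ) / (I : ℝ)) (batch m) z)
    (continuous_pi fun m => (contDiff_scaledGradient x _ _ 1).continuous).continuousOn
  obtain ⟨L, hL0, hL⟩ := exists_lipschitz_bound_of_contDiff
    (contDiff_scaledGradient (N := N) x (1 / (I : ℝ)) Finset.univ 1) R
  have hstep : ∀ t p, dist (selectedRun x batch ρ ω τ a (t + 1) p).1
      (selectedRun x batch ρ ω τ a t p).1 ≤ (1 + R) * ω (t + 1) := by
    intro t p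
    have hpos := hω.pos (t + 1) (by omega)
    have hdiff : (selectedRun x batch ρ ω τ a (t + 1) p).1 - (selectedRun x batch ρ ω τ a t p).1
        = ω (t + 1) • (surrogateMaximizer τ (selectedRun x batch ρ ω τ a t p).1
          (selectedRun x batch ρ ω τ a (t + 1) p).2 - (selectedRun x batch ρ ω τ a t p).1) := by
      rw [selectedRun_succ_fst]
      module
    rw [dist_eq_norm, hdiff, norm_smul, Real.norm_of_nonneg hpos.le, mul_comm]
    exact mul_le_mul_of_nonneg_right ((norm_sub_le _ _).trans (add_le_add
      (norm_le_one_of_mem_feasibleSet (surrogateMaximizer_mem_feasibleSet a _ _ _)) (hR t p)))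
      hpos.le
  -- Scalar tracking is applied to each linear functional of the gradient; finitely many coordinates
  -- then cost finitely many null sets.
  have hcoord : ∀ π : (Fin K → Fin N → ℝ) × ℝ →L[ℝ] ℝ,
      ∀ᵐ w ∂P, Tendsto (fun t => π ((selectedRun x batch ρ ω τ a t fun s => ξ s w).2
      - scaledGradient x (1 / (I : ℝ)) Finset.univ
          (selectedRun x batch ρ ω τ a t fun s => ξ s w).1)) atTop (𝓝 0) := by
    intro π
    have havg : ∀ z, (M : ℝ)⁻¹ * ∑ m, π (scaledGradient x ((M : ℝ) / (I : ℝ)) (batch m) z)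
        = π (scaledGradient x (1 / (I : ℝ)) Finset.univ z) := by
      intro z
      rw [← average_scaledGradient hbatch hM, map_smul, map_sum, smul_eq_mul]
    have h := ae_tendsto_average_sub (P := P) hξ hunif hind hρ hωρ
      (Z := fun t p => (selectedRun x batch ρ ω τ a t p).1)
      (fun t p q hpq => by rw [selectedRun_congr a t hpq]) hB hstep
      (h := fun m z => π (scaledGradient x ((M : ℝ) / (I : ℝ)) (batch m) z))
      (C := ‖π‖ * C) (L := ‖π‖ * L) ?_ (by positivity) ?_
      (c := fun t p => π (selectedRun x batch ρ ω τ a t p).2) ?_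
    · filter_upwards [h] with w hw
      refine hw.congr fun t => ?_
      rw [havg, map_sub]
    · intro m z hz
      refine (π.le_opNorm _).trans (mul_le_mul_of_nonneg_left ?_ (norm_nonneg _))
      exact (norm_le_pi_norm
        (fun m => scaledGradient x ((M : ℝ) / (I : ℝ)) (batch m) z) m).trans (hC z hz)
    · intro y hy z hz
      rw [havg, havg, ← map_sub, mul_assoc]
      exact (π.le_opNorm _).trans (mul_le_mul_of_nonneg_left (hL y hy z hz) (norm_nonneg _))
    · intro t p
      rw [selectedRun_succ_snd, map_add, map_smul, map_smul, smul_eq_mul, smul_eq_mul]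
  have hA : ∀ᵐ w ∂P, ∀ k n, Tendsto (fun t => ((selectedRun x batch ρ ω τ a t fun s => ξ s w).2
      - scaledGradient x (1 / (I : ℝ)) Finset.univ
          (selectedRun x batch ρ ω τ a t fun s => ξ s w).1).1 k n) atTop (𝓝 0) :=
    ae_all_iff.2 fun k => ae_all_iff.2 fun n =>
      hcoord ((ContinuousLinearMap.proj (R := ℝ) (φ := fun _ : Fin N => ℝ) n).comp
        ((ContinuousLinearMap.proj (R := ℝ) (φ := fun _ : Fin K => Fin N → ℝ) k).comp
          (ContinuousLinearMap.fst ℝ (Fin K → Fin N → ℝ) ℝ)))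
  filter_upwards [hA, hcoord (ContinuousLinearMap.snd ℝ (Fin K → Fin N → ℝ) ℝ)] with w h1 h2
  exact (tendsto_pi_nhds.2 fun k => tendsto_pi_nhds.2 fun n => h1 k n).prodMk_nhds h2

end Convergence

end RandomAccess

end

/-! ### Assembly of the convergence theorem -/

theorem theorem8 {K N I M : ℕ} (hI : 0 < I)
    -- the samples of the device activity states, and their mini-batches
    (x : Fin I → Fin K → ℝ) (hx : ∀ i k, x i k = 0 ∨ x i k = 1)
    (batch : Fin M → Finset (Fin I)) (hbatch : RandomAccess.IsMiniBatchPartition batch)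
    -- the step sizes and the proximal constant
    (ρ ω : ℕ → ℝ) (hρ : RandomAccess.IsDiminishingStepSize ρ)
    (hω : RandomAccess.IsDiminishingStepSize ω)
    (hωρ : Tendsto (fun t => ω t / ρ t) atTop (𝓝 0))
    (τ : ℝ) (hτ : 0 < τ)
    -- the randomness: initial preambles, and independent uniform mini-batch indices
    {Ω : Type*} [MeasurableSpace Ω] (P : Measure Ω) [IsProbabilityMeasure P]
    (n₀ : Fin K → Ω → Fin N) (hn₀_meas : ∀ k, Measurable (n₀ k))
    (hn₀_unif : ∀ k n, P (n₀ k ⁻¹' {n}) = (N : ℝ≥0∞)⁻¹)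
    (ξ : ℕ → Ω → Fin M) (hξ_meas : ∀ t, Measurable (ξ t))
    (hξ_unif : ∀ t m, P (ξ t ⁻¹' {m}) = (M : ℝ≥0∞)⁻¹)
    (hξ_indep : iIndepFun ξ P)
    (hn₀ξ_indep : IndepFun (fun w k => n₀ k w) (fun w t => ξ t w) P)
    -- the iterates
    (A : ℕ → Ω → Fin K → Fin N → ℝ) (ε : ℕ → Ω → ℝ)
    (hrun : ∀ w, RandomAccess.IsSCARun x batch ρ ω τ (fun k => n₀ k w) (fun t => ξ t w)
      (fun t => A t w) (fun t => ε t w)) :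
    -- almost surely, on the runs whose maximisers are all unique
    ∀ᵐ w ∂P,
      (∀ t, 1 ≤ t → ∀ k, ∃ n, RandomAccess.argmaxSet
        (RandomAccess.cA x batch ρ (fun s => ξ s w) (fun s => A s w) (fun s => ε s w) t k)
          = {n}) →
      ∀ z : (Fin K → Fin N → ℝ) × ℝ,
        MapClusterPt z atTop (fun t => (A t w, ε t w)) →
        RandomAccess.IsStationaryPointMax (RandomAccess.sampleThroughput x)
          (RandomAccess.feasibleSet K N) z := by
  have hM : 0 < M := Nat.pos_of_ne_zero fun h => by
    have := hbatch.dvd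
    rw [h, zero_dvd_iff] at this
    omega
  obtain ⟨R, -, hR⟩ := RandomAccess.exists_norm_le_of_convexCombination
    (E := (Fin K → Fin N → ℝ) × ℝ) hω
  have hRrun : ∀ (a : Fin K → Fin N) t (p : ℕ → Fin M),
      ‖(RandomAccess.selectedRun x batch ρ ω τ a t p).1‖ ≤ R := fun a t p =>
    hR (fun t => (RandomAccess.selectedRun x batch ρ ω τ a t p).1) _
      (RandomAccess.norm_selectedRun_zero_le a p)
      (fun t => RandomAccess.norm_le_one_of_mem_feasibleSet
        (RandomAccess.surrogateMaximizer_mem_feasibleSet a _ _ _))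
      (fun t => RandomAccess.selectedRun_succ_fst a t p) t
  -- There are finitely many initial preamble vectors, so one null set serves all of them and the
  -- random vector can be substituted pointwise.
  have hall := ae_all_iff.2 fun a : Fin K → Fin N =>
    RandomAccess.ae_tendsto_selectedRun_sub_gradient (P := P) hξ_meas hξ_unif hξ_indep hbatch hM
      hρ hω hωρ a (hRrun a)
  filter_upwards [hall] with w hw huniq z hz
  have heq := (hrun w).eq_selectedRun huniq
  refine RandomAccess.isStationaryPointMax_of_tendsto_gradient (fun k => n₀ k w) x hω hτ
    (hRrun (fun k => n₀ k w) · fun s => ξ s w)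
    (fun t => RandomAccess.selectedRun_succ_fst (fun k => n₀ k w) t fun s => ξ s w)
    (hw fun k => n₀ k w) ?_
  simpa only [heq] using hz
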